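/- **Setting.** Let $E$ be a Dedekind complete Riesz space with weak order unit $e$, and let $E^u$ be its universal completion with its $f$-algebra multiplication having unit $e$; all products below are taken in $E^u$. A *conditional expectation operator* on a Dedekind complete Riesz space with weak order unit is a positive order continuous linear projection whose range $\mathcal R(\cdot)$ is a Dedekind complete Riesz subspace and which maps weak order units to weak order units. Let $T$ be a strictly positive conditional expectation operator on $E$ with $Te=e$, and let $E$ be $T$-universally complete, i.e. $E$ is the maximal domain in $E^u$ to which $T$ extends as a conditional expectation operator. A conditional expectation operator $S$ on $E$ is *compatible* with $T$ if $ST=TS=T$. Here $\mathbb N=\{0,1,2,\dots\}$ and all convergence is order convergence. Put $\mathcal L^1(T)=E$, $\mathcal L^2(T)=\{f\in E: f^2\in E\}$, $\mathcal L^\infty(T)=\{f\in E: |f|\le g\text{ for some }g\in\mathcal R(T)_+\}$, with the $T$-conditional norms $\|f\|_{T,1}=T|f|$, $\|f\|_{T,2}=\sqrt{T|f|^2}$, $\|f\|_{T,\infty}=\inf\{g\in\mathcal R(T)_+:|f|\le g\}$. Let $(T_i^j)_{i\le j}$, $i,j\in\mathbb Z$, be conditional expectation operators on $E$ compatible with $T$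 such that $\mathcal R(T_{i+1}^j)\subset\mathcal R(T_i^j)\subset\mathcal R(T_i^{j+1})$ for all $i<j$. Let $T_{-\infty}^n$ and $T_n^\infty$ be the conditional expectation operators compatible with $T$ whose ranges are the smallest order closed Riesz subspaces of $E$ containing $\bigcup_{i\le j\le n}\mathcal R(T_i^j)$ and $\bigcup_{n\le i\le j}\mathcal R(T_i^j)$, respectively. *Mixing.* For a conditional expectation operator $S$ let $\mathcal B(S)$ be the set of band projections $P$ on $E$ with $Pe\in\mathcal R(S)$. For $V,W$ compatible with $T$ let $$\alpha_T(V,W)=\sup\{|TPQe-TPe\cdot TQe|:P\in\mathcal B(V),\,Q\in\mathcal B(W)\},\qquad \varphi_T(V,W)=\sup\{\|VQe-TQe\|_{T,\infty}:Q\in\mathcal B(W)\},$$ and for $m\in\mathbb N$ let $\alpha_{T,m}=\sup_{n\in\mathbb Z}\alpha_T(T_{-\infty}^n,T_{n+m}^\infty)$ and $\varphi_{T,m}=\sup_{n\in\mathbb Z}\varphi_T(T_{-\infty}^n,T_{n+m}^\infty)$. The family $(T_i^j)$ is *$\alpha_T$-mixing* (*$\varphi_T$-mixing*) if $\alpha_{T,m}\to0$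 ($\varphi_{T,m}\to0$) as $m\to\infty$. *Near-epoch dependence.* For $p\in\{1,2,\infty\}$, $(f_n)_{n\in\mathbb Z}\subset\mathcal L^p(T)$ is *near-epoch dependent in $\mathcal L^p(T)$ on $(T_i^j)$* with $(d_n)_{n\in\mathbb Z}\subset\mathcal L^p(T)_+$ and $(\xi_m)_{m\in\mathbb N}\subset\mathcal R(T)_+$ if $\xi_m\to0$ and $\|f_n-T_{n-m}^{n+m}f_n\|_{T,p}\le d_n\xi_m$ for all $n\in\mathbb Z$, $m\in\mathbb N$; it is near-epoch dependent if such sequences exist. *Mixingale.* $(f_n,R_n)_{n\in\mathbb Z}$ is a *mixingale in $\mathcal L^1(T)$* with $(c_n)_{n\in\mathbb Z}\subset\mathcal L^1(T)_+$ and $(\phi_m)_{m\in\mathbb N}\subset\mathcal R(T)_+$ if the $R_n$ are conditional expectation operators on $E$ compatible with $T$ with $R_mR_n=R_nR_m=R_m$ for $m\le n$, $(f_n)\subset\mathcal L^1(T)$, $\phi_m\to0$, and for all $n\in\mathbb Z$, $m\in\mathbb N$ $$\|R_{n-m}f_n\|_{T,1}\le c_n\phi_m,\qquad \|f_n-R_{n+m}f_n\|_{T,1}\le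 c_n\phi_{m+1};$$ it is a mixingale if such sequences exist. **Theorem.** Let $p\in\{1,2,\infty\}$ and let $(f_n)_{n\in\mathbb Z}\subset\mathcal L^\infty(T)$ be near-epoch dependent in $\mathcal L^p(T)$ on $(T_i^j)$ with $Tf_n=0$ for all $n$. If $(T_i^j)$ is $\alpha_T$-mixing or $\varphi_T$-mixing, then $(f_n,T_{-\infty}^n)_{n\in\mathbb Z}$ is a mixingale in $\mathcal L^1(T)$. Moreover, whenever $(f_n)$ is near-epoch dependent with the sequences $(d_n)$ and $(\xi_m)$, the mixingale property holds with $$c_n=d_n\vee\|f_n\|_{T,\infty},\qquad \phi_m=2\big(\xi_{\lfloor m/2\rfloor}+\min\{2\alpha_{T,\lfloor m/2\rfloor},\,\varphi_{T,\lfloor m/2\rfloor}\}\big).$$ -/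

import Mathlib

open Filter

set_option linter.unusedSectionVars false

namespace RieszMixing

section Basic

variable {X : Type*} [AddCommGroup X] [Module ℝ X] [Lattice X]

/-- `u` is a weak order unit: `u ≥ 0` and only `0` is disjoint from `u`. -/
def IsWeakOrderUnit (u : X) : Prop :=
  0 ≤ u ∧ ∀ x : X, |x| ⊓ u = 0 → x = 0

/-- Order convergence of `x` to `a` along a filter: there is a set `D ↓ 0` each of whose members
eventually dominates `|x i - a|`. For sequences take the filter `atTop`. -/
def OrderTendsto {I : Type*} (x : I → X) (l : Filter I) (a : X) : Prop :=
  ∃ D : Set X, D.Nonempty ∧ DirectedOn (· ≥ ·) D ∧ IsGLB D 0 ∧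
    ∀ d ∈ D, ∀ᶠ i in l, |x i - a| ≤ d

/-- Closed with respect to order limits. -/
def IsOrderClosed (S : Set X) : Prop :=
  ∀ (l : Filter X) (a : X), l.NeBot → S ∈ l → OrderTendsto id l a → a ∈ S

/-- Every nonempty subset that is bounded above has a supremum. -/
def IsDedekindComplete (Y : Type*) [Preorder Y] : Prop :=
  ∀ s : Set Y, s.Nonempty → BddAbove s → ∃ a, IsLUB s a

variable (X) in
/-- A Riesz subspace: a linear subspace that is a sublattice. -/
structure RieszSubspace extends Submodule ℝ X where
  sup_mem' : ∀ x y, x ∈ carrier → y ∈ carrier → x ⊔ y ∈ carrier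
  inf_mem' : ∀ x y, x ∈ carrier → y ∈ carrier → x ⊓ y ∈ carrier

/-- The induced lattice structure of a Riesz subspace. -/
instance (F : RieszSubspace X) : Lattice F.toSubmodule :=
  Subtype.lattice (fun {x y} hx hy => F.sup_mem' x y hx hy)
    (fun {x y} hx hy => F.inf_mem' x y hx hy)

/-- The smallest order closed Riesz subspace that contains `A`. -/
def generated (A : Set X) : Set X :=
  {x | ∀ F : RieszSubspace X, A ⊆ (F.toSubmodule : Set X) →
    IsOrderClosed (F.toSubmodule : Set X) → x ∈ F.toSubmodule}

/-- Conditional expectation operators on a (Dedekind complete) Riesz space `X` (with weak order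
unit): positive order continuous linear projections whose range is a Dedekind complete Riesz
subspace and which map weak order units to weak order units. -/
structure IsCondExp (T : X →ₗ[ℝ] X) : Prop where
  map_nonneg : ∀ x, 0 ≤ x → 0 ≤ T x
  order_continuous : ∀ D : Set X, D.Nonempty → DirectedOn (· ≥ ·) D → IsGLB D 0 →
    IsGLB (T '' D) 0
  idem : ∀ x, T (T x) = T x
  range_sup : ∀ x y, x ∈ Set.range T → y ∈ Set.range T → x ⊔ y ∈ Set.range T
  range_inf : ∀ x y, x ∈ Set.range T → y ∈ Set.range T → x ⊓ y ∈ Set.range T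
  range_complete : IsDedekindComplete (Set.range T)
  map_weakOrderUnit : ∀ u, IsWeakOrderUnit u → IsWeakOrderUnit (T u)

/-- `S` is compatible with `T`: `ST = TS = T`. -/
def IsCompatible (S T : X →ₗ[ℝ] X) : Prop :=
  (∀ x, S (T x) = T x) ∧ ∀ x, T (S x) = T x

/-- Strict positivity of a positive operator. -/
def IsStrictlyPositive (T : X →ₗ[ℝ] X) : Prop :=
  ∀ x, 0 < x → 0 < T x

/-- Band projections: linear projections `P` with `0 ≤ P ≤ I`. -/
def IsBandProjection (P : X →ₗ[ℝ] X) : Prop :=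
  (∀ x, P (P x) = P x) ∧ ∀ x, 0 ≤ x → 0 ≤ P x ∧ P x ≤ x

/-- The class `𝓑(S)` of the band projections `P` with `P e` in the range of `S`. -/
def bandProjections (e : X) (S : X →ₗ[ℝ] X) : Set (X →ₗ[ℝ] X) :=
  {P | IsBandProjection P ∧ P e ∈ Set.range S}

end Basic

section Spaces

variable {E U : Type*}
  [AddCommGroup E] [Module ℝ E] [ConditionallyCompleteLattice E] [IsOrderedAddMonoid E]
  [IsOrderedModule ℝ E]
  [CommRing U] [Algebra ℝ U] [ConditionallyCompleteLattice U] [IsOrderedRing U]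
  [IsOrderedModule ℝ U]

/-- `U` is (via `ι`) the universal completion of the Dedekind complete Riesz space `E`, with the
`f`-algebra multiplication whose unit is `e`: a Dedekind complete Riesz space in which every set of
mutually disjoint positive elements has a supremum, containing `E` as an order dense Riesz
subspace. These properties determine `U` and its multiplication up to a unique isomorphism
over `E`. -/
structure IsUniversalCompletion (ι : E →ₗ[ℝ] U) (e : E) : Prop where
  injective : Function.Injective ι
  map_sup : ∀ x y, ι (x ⊔ y) = ι x ⊔ ι y
  order_dense : ∀ u : U, 0 < u → ∃ x : E, 0 < ι x ∧ ι x ≤ u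
  disjoint_sup : ∀ s : Set U, s.Nonempty → (∀ u ∈ s, 0 ≤ u) →
    s.Pairwise (fun u v => u ⊓ v = 0) → ∃ a, IsLUB s a
  mul_disjoint : ∀ a b c : U, 0 ≤ c → a ⊓ b = 0 → (c * a) ⊓ b = 0
  map_unit : ι e = 1

/-- `E` is `T`-universally complete: it is the maximal domain in its universal completion to which
`T` can be extended as a conditional expectation operator. -/
def IsTUniversallyComplete (ι : E →ₗ[ℝ] U) (T : E →ₗ[ℝ] E) : Prop :=
  ∀ (F : RieszSubspace U) (hF : ∀ x, ι x ∈ F.toSubmodule)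
    (T' : F.toSubmodule →ₗ[ℝ] F.toSubmodule),
    IsDedekindComplete F.toSubmodule → IsCondExp T' →
    (∀ x, (T' ⟨ι x, hF x⟩ : U) = ι (T x)) →
    ∀ u ∈ F.toSubmodule, u ∈ Set.range ι

open Classical in
/-- The product in the universal completion of two elements of `E`, for products that lie in `E`
(`0` for other pairs). -/
noncomputable def mulE (ι : E →ₗ[ℝ] U) (x y : E) : E :=
  if h : ∃ z, ι z = ι x * ι y then h.choose else 0

theorem map_mulE (ι : E →ₗ[ℝ] U) (x y : E) (h : ∃ z, ι z = ι x * ι y) :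
    ι (mulE ι x y) = ι x * ι y := by
  unfold mulE
  rw [dif_pos h]
  exact h.choose_spec

/-- The square root of `x ∈ E₊`: the largest `y ∈ E₊` with `y ^ 2 ≤ x`. -/
noncomputable def sqrtE (ι : E →ₗ[ℝ] U) (x : E) : E :=
  sSup {y : E | 0 ≤ y ∧ ι y * ι y ≤ ι x}

/-- In the universal completion, `y ^ 2 ≤ s ^ 2` implies `y ≤ s` for positive `y`, `s`. -/
theorem le_of_mul_self_le {ι : E →ₗ[ℝ] U} {e : E} (h : IsUniversalCompletion ι e) {y s : U}
    (hy : 0 ≤ y) (hs : 0 ≤ s) (hys : y * y ≤ s * s) : y ≤ s := by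
  have disj : ∀ a : U, a⁺ ⊓ a⁻ = 0 := fun a => posPart_inf_negPart_eq_zero a
  have mulDisj : ∀ a b c : U, 0 ≤ c → a ⊓ b = 0 → (c * a) ⊓ (c * b) = 0 := by
    intro a b c hc hab
    have h1 := h.mul_disjoint a b c hc hab
    rw [inf_comm] at h1
    have h2 := h.mul_disjoint b (c * a) c hc h1
    rwa [inf_comm] at h2
  have key : ∀ a c : U, 0 ≤ c → c * a ≤ 0 → c * a⁺ = 0 := by
    intro a c hc hca
    have h1 := mulDisj _ _ c hc (disj a)
    have h2 : c * a⁺ ≤ c * a⁻ := by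
      have h3 : c * a = c * a⁺ - c * a⁻ := by rw [← mul_sub, posPart_sub_negPart]
      rw [h3] at hca
      exact sub_nonpos.mp hca
    rwa [inf_eq_left.mpr h2] at h1
  set u := (y - s)⁺ with hu
  have u0 : 0 ≤ u := posPart_nonneg _
  have huy : u ≤ y + s := by
    rw [hu, posPart_def]
    refine sup_le ?_ (add_nonneg hy hs)
    have : y - s ≤ y := sub_le_self y hs
    exact this.trans (le_add_of_nonneg_right hs)
  have hcu : (y + s) * u = 0 := by
    refine key _ _ (add_nonneg hy hs) ?_
    have : (y + s) * (y - s) = y * y - s * s := by ring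
    rw [this]
    exact sub_nonpos.mpr hys
  have huu : u * u = 0 := by
    refine le_antisymm ?_ (mul_nonneg u0 u0)
    rw [← hcu]
    exact mul_le_mul_of_nonneg_right huy u0
  have hn : ∀ n : ℕ, n • u ≤ 1 := by
    intro n
    set w := (n • u - 1)⁺ with hw
    have w0 : 0 ≤ w := posPart_nonneg _
    have hwn : w ≤ n • u := by
      rw [hw, posPart_def]
      exact sup_le (sub_le_self _ zero_le_one) (nsmul_nonneg u0 n)
    have hwu : w * (n • u) = 0 := by
      refine le_antisymm ?_ (mul_nonneg w0 (nsmul_nonneg u0 n))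
      have h1 : w * (n • u) ≤ (n • u) * (n • u) :=
        mul_le_mul_of_nonneg_right hwn (nsmul_nonneg u0 n)
      have h2 : (n • u) * (n • u) = 0 := by
        rw [smul_mul_smul_comm, huu, smul_zero]
      rwa [h2] at h1
    have h3 : w * w = 0 := by
      refine key _ _ w0 ?_
      rw [mul_sub, hwu, mul_one, zero_sub]
      exact neg_nonpos.mpr w0
    have h4 : w * (n • u - 1) = w * w - w * (n • u - 1)⁻ := by
      rw [← mul_sub, hw, posPart_sub_negPart]
    have h5 : w = w * (n • u - 1)⁻ := by
      have h6 := h4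
      rw [mul_sub, hwu, h3, mul_one, zero_sub, zero_sub] at h6
      exact neg_inj.mp h6
    have h7 : (w * (n • u - 1)⁻) ⊓ w = 0 := by
      have := h.mul_disjoint _ _ w w0 (by rw [inf_comm]; exact disj (n • u - 1))
      exact this
    rw [← h5, inf_idem] at h7
    have h8 : n • u - 1 ≤ w := le_posPart _
    rw [h7] at h8
    exact sub_nonpos.mp h8
  have hbdd : BddAbove (Set.range fun n : ℕ => n • u) := ⟨1, by rintro _ ⟨n, rfl⟩; exact hn n⟩
  have hlub := isLUB_csSup (Set.range_nonempty _) hbdd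
  set t := sSup (Set.range fun n : ℕ => n • u)
  have ht : t ≤ t - u := by
    refine hlub.2 ?_
    rintro _ ⟨n, rfl⟩
    have := hlub.1 ⟨n + 1, rfl⟩
    simp only [succ_nsmul] at this
    exact le_sub_iff_add_le.mpr this
  have hu0 : u ≤ 0 := by simpa using ht
  have h9 : y - s ≤ u := le_posPart _
  exact sub_nonpos.mp (h9.trans hu0)

/-- `sqrtE ι x` is the positive square root of `x`. -/
theorem sqrtE_eq {ι : E →ₗ[ℝ] U} {e : E} (h : IsUniversalCompletion ι e) {x s : E}
    (hs : 0 ≤ s) (hx : ι s * ι s = ι x) : sqrtE ι x = s := by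
  have hmono : ∀ {a b : E}, ι a ≤ ι b → a ≤ b := by
    intro a b hab
    have h1 : ι (a ⊔ b) = ι b := by rw [h.map_sup, sup_eq_right.mpr hab]
    exact sup_eq_right.mp (h.injective h1)
  have hpos : ∀ {a : E}, 0 ≤ a → 0 ≤ ι a := by
    intro a ha
    have h1 : ι 0 ⊔ ι a = ι a := by rw [← h.map_sup, sup_eq_right.mpr ha]
    rw [map_zero] at h1
    exact sup_eq_right.mp h1
  refine IsGreatest.csSup_eq ⟨⟨hs, hx.le⟩, ?_⟩
  rintro y ⟨hy, hyx⟩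
  exact hmono (le_of_mul_self_le h (hpos hy) (hpos hs) (hyx.trans hx.ge))

/-- The three exponents `1`, `2`, `∞`. -/
inductive Exponent
  | one
  | two
  | top

/-- The spaces `𝓛ᵖ(T)` for `p ∈ {1, 2, ∞}`, when `E = dom(T)`. -/
def Lp (ι : E →ₗ[ℝ] U) (T : E →ₗ[ℝ] E) : Exponent → Set E
  | .one => Set.univ
  | .two => {f | ∃ g : E, ι g = ι f * ι f}
  | .top => {f | ∃ g ∈ Set.range T, 0 ≤ g ∧ |f| ≤ g}

/-- The `T`-conditional norms `‖f‖_{T,p}` for `p ∈ {1, 2, ∞}`. -/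
noncomputable def condNorm (ι : E →ₗ[ℝ] U) (T : E →ₗ[ℝ] E) : Exponent → E → E
  | .one, f => T |f|
  | .two, f => sqrtE ι (T (mulE ι |f| |f|))
  | .top, f => sInf {g | g ∈ Set.range T ∧ 0 ≤ g ∧ |f| ≤ g}

/-- The `T`-conditional strong mixing coefficient
`α_T(V, W) = sup {|T P Q e - T P e · T Q e| : P ∈ 𝓑(V), Q ∈ 𝓑(W)}`. -/
noncomputable def alphaT (ι : E →ₗ[ℝ] U) (e : E) (T V W : E →ₗ[ℝ] E) : E :=
  sSup {x | ∃ P ∈ bandProjections e V, ∃ Q ∈ bandProjections e W,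
    x = |T (P (Q e)) - mulE ι (T (P e)) (T (Q e))|}

/-- The `T`-conditional uniform mixing coefficient
`φ_T(V, W) = sup {‖V Q e - T Q e‖_{T,∞} : Q ∈ 𝓑(W)}`. -/
noncomputable def phiT (ι : E →ₗ[ℝ] U) (e : E) (T V W : E →ₗ[ℝ] E) : E :=
  sSup {x | ∃ Q ∈ bandProjections e W, x = condNorm ι T .top (V (Q e) - T (Q e))}

/-- `α_{T,m} = sup_n α_T(T_{-∞}^n, T_{n+m}^∞)`. -/
noncomputable def alphaSeq (ι : E →ₗ[ℝ] U) (e : E) (T : E →ₗ[ℝ] E)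
    (past future : ℤ → E →ₗ[ℝ] E) (m : ℕ) : E :=
  sSup (Set.range fun n : ℤ => alphaT ι e T (past n) (future (n + m)))

/-- `φ_{T,m} = sup_n φ_T(T_{-∞}^n, T_{n+m}^∞)`. -/
noncomputable def phiSeq (ι : E →ₗ[ℝ] U) (e : E) (T : E →ₗ[ℝ] E)
    (past future : ℤ → E →ₗ[ℝ] E) (m : ℕ) : E :=
  sSup (Set.range fun n : ℤ => phiT ι e T (past n) (future (n + m)))

/-- `(S i j)`, `i ≤ j`, is a family of conditional expectation operators compatible with `T` whose
ranges increase as the index interval grows. -/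
structure IsNestedFamily (T : E →ₗ[ℝ] E) (S : ℤ → ℤ → E →ₗ[ℝ] E) : Prop where
  condExp : ∀ i j, i ≤ j → IsCondExp (S i j)
  compatible : ∀ i j, i ≤ j → IsCompatible (S i j) T
  range_left : ∀ i j, i < j → Set.range (S (i + 1) j) ⊆ Set.range (S i j)
  range_right : ∀ i j, i < j → Set.range (S i j) ⊆ Set.range (S i (j + 1))

/-- `past n` is `T_{-∞}^n`: the conditional expectation operator compatible with `T` whose range is
generated by the ranges of the `S i j` with `i ≤ j ≤ n`. -/
structure IsPast (T : E →ₗ[ℝ] E) (S : ℤ → ℤ → E →ₗ[ℝ] E) (past : ℤ → E →ₗ[ℝ] E) : Prop where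
  condExp : ∀ n, IsCondExp (past n)
  compatible : ∀ n, IsCompatible (past n) T
  range_eq : ∀ n, Set.range (past n) =
    generated {x | ∃ i j, i ≤ j ∧ j ≤ n ∧ x ∈ Set.range (S i j)}

/-- `future n` is `T_n^∞`: the conditional expectation operator compatible with `T` whose range is
generated by the ranges of the `S i j` with `n ≤ i ≤ j`. -/
structure IsFuture (T : E →ₗ[ℝ] E) (S : ℤ → ℤ → E →ₗ[ℝ] E) (future : ℤ → E →ₗ[ℝ] E) :
    Prop where
  condExp : ∀ n, IsCondExp (future n)
  compatible : ∀ n, IsCompatible (future n) T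
  range_eq : ∀ n, Set.range (future n) =
    generated {x | ∃ i j, n ≤ i ∧ i ≤ j ∧ x ∈ Set.range (S i j)}

/-- `α_T`-mixing. -/
def IsAlphaMixing (ι : E →ₗ[ℝ] U) (e : E) (T : E →ₗ[ℝ] E) (past future : ℤ → E →ₗ[ℝ] E) :
    Prop :=
  OrderTendsto (alphaSeq ι e T past future) atTop 0

/-- `φ_T`-mixing. -/
def IsPhiMixing (ι : E →ₗ[ℝ] U) (e : E) (T : E →ₗ[ℝ] E) (past future : ℤ → E →ₗ[ℝ] E) :
    Prop :=
  OrderTendsto (phiSeq ι e T past future) atTop 0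

/-- `(f n)` is near-epoch dependent in `𝓛ᵖ(T)` on `(S i j)` with the sequences `d` and `ξ`. The
product `d n * ξ m` is formed in the universal completion. -/
structure IsNEDWith (ι : E →ₗ[ℝ] U) (T : E →ₗ[ℝ] E) (p : Exponent) (S : ℤ → ℤ → E →ₗ[ℝ] E)
    (f : ℤ → E) (d : ℤ → E) (ξ : ℕ → E) : Prop where
  mem : ∀ n, f n ∈ Lp ι T p
  d_mem : ∀ n, d n ∈ Lp ι T p
  d_nonneg : ∀ n, 0 ≤ d n
  xi_mem : ∀ m, ξ m ∈ Set.range T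
  xi_nonneg : ∀ m, 0 ≤ ξ m
  xi_tendsto : OrderTendsto ξ atTop 0
  bound : ∀ (n : ℤ) (m : ℕ),
    ι (condNorm ι T p (f n - S (n - m) (n + m) (f n))) ≤ ι (d n) * ι (ξ m)

/-- `(f n)` is near-epoch dependent in `𝓛ᵖ(T)` on `(S i j)`. -/
def IsNED (ι : E →ₗ[ℝ] U) (T : E →ₗ[ℝ] E) (p : Exponent) (S : ℤ → ℤ → E →ₗ[ℝ] E)
    (f : ℤ → E) : Prop :=
  ∃ d ξ, IsNEDWith ι T p S f d ξ

/-- `(f n, R n)` is a mixingale in `𝓛ᵖ(T)` with the sequences `c` and `φ`; this includes that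
`(R n)` is a filtration of conditional expectation operators compatible with `T`. -/
structure IsMixingaleWith (ι : E →ₗ[ℝ] U) (T : E →ₗ[ℝ] E) (p : Exponent) (f : ℤ → E)
    (R : ℤ → E →ₗ[ℝ] E) (c : ℤ → E) (φ : ℕ → E) : Prop where
  condExp : ∀ n, IsCondExp (R n)
  compatible : ∀ n, IsCompatible (R n) T
  filtration : ∀ m n, m ≤ n → ∀ x, R m (R n x) = R m x ∧ R n (R m x) = R m x
  mem : ∀ n, f n ∈ Lp ι T p
  c_mem : ∀ n, c n ∈ Lp ι T p
  c_nonneg : ∀ n, 0 ≤ c n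
  phi_mem : ∀ m, φ m ∈ Set.range T
  phi_nonneg : ∀ m, 0 ≤ φ m
  phi_tendsto : OrderTendsto φ atTop 0
  bound_past : ∀ (n : ℤ) (m : ℕ),
    ι (condNorm ι T p (R (n - m) (f n))) ≤ ι (c n) * ι (φ m)
  bound_future : ∀ (n : ℤ) (m : ℕ),
    ι (condNorm ι T p (f n - R (n + m) (f n))) ≤ ι (c n) * ι (φ (m + 1))

/-- `(f n, R n)` is a mixingale in `𝓛ᵖ(T)`. -/
def IsMixingale (ι : E →ₗ[ℝ] U) (T : E →ₗ[ℝ] E) (p : Exponent) (f : ℤ → E)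
    (R : ℤ → E →ₗ[ℝ] E) : Prop :=
  ∃ c φ, IsMixingaleWith ι T p f R c φ

end Spaces

end RieszMixing

namespace RieszMixing

-- Fix a lag m, put k = ⌊m/2⌋ and replace f_n by g = `S (n - k) (n + k) (f n)`. Then T g = 0 and |g|
-- ≤ a := ‖f_n‖_{T,∞}. Also T|f_n - g| ≤ d_n ξ_k, because each of the three norms dominates T|·|
-- (`map_abs_le_condNorm`; for p = 2 this is Jensen's inequality). Since n - m + k ≤ n - k, g is
-- measurable for the future from n - m + k. With V the past operator at n - m, T|V f_n| ≤ T|f_n -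
-- g| + T|V g|, and the last term is governed by mixing across a gap of length k. For the other
-- bound take k = ⌊(m+1)/2⌋ ≤ m: now the past operator at n + m fixes g, so the error is at most 2
-- T|f_n - g|.
--
-- The core is T|V g| ≤ 4aα and T|V g| ≤ 2aφ (`map_abs_le_alphaT`, `map_abs_le_phiT`). Both come
-- from `IsCondExp.layer_bound`: g + a lies between 0 and 2a and is approximated by sums of level
-- bands, on each of which the coefficient applies directly; the mesh then tends to 0.
--
-- There is no measure space. Indicator functions are replaced by idempotents of the universal
-- completion, which act on E as band projections because E is an ideal there. Truncation to {a ≤ N}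
-- becomes multiplication by 1 - supp (a - N)⁺, and `nonpos_of_localized` removes it. On this basis
-- rest commutation with measurable bands (`map_bandMul_comm`), averaging, Jensen (`sq_map_le`) and,
-- by strict positivity of T, the tower property that makes the past operators a filtration.

-- Lattice-ordered groups and the Archimedean property

theorem le_of_sub_eq {X : Type*} [AddCommGroup X] [PartialOrder X] [IsOrderedAddMonoid X]
    {x y r : X} (hr : 0 ≤ r) (h : y - x = r) : x ≤ y :=
  sub_nonneg.1 (h ▸ hr)

theorem abs_sub_le_add {X : Type*} [AddCommGroup X] [Lattice X] [IsOrderedAddMonoid X] (x y : X) :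
    |x - y| ≤ |x| + |y| := by
  have := abs_add_le x (-y)
  rwa [abs_neg, ← sub_eq_add_neg] at this

theorem sub_posPart_sub {X : Type*} [AddCommGroup X] [Lattice X] [IsOrderedAddMonoid X] (v d : X) :
    v - (v - d)⁺ = v ⊓ d := by
  have h1 : (v - d)⁺ = v ⊔ d - d := by
    rw [posPart_def, sub_eq_add_neg, sub_eq_add_neg, sup_add, add_neg_cancel]
  have h2 := inf_add_sup v d
  rw [h1, sub_sub_eq_add_sub, ← h2, add_sub_cancel_right]

theorem posPart_sub_of_nonneg {X : Type*} [AddCommGroup X] [Lattice X] [IsOrderedAddMonoid X]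
    (x : X) {d : X} (hd : 0 ≤ d) : (x⁺ - d)⁺ = (x - d)⁺ := by
  simp only [posPart_def]
  rw [sub_eq_add_neg, sup_add, zero_add, ← sub_eq_add_neg, sup_assoc,
    sup_eq_right.2 (neg_nonpos.2 hd)]

/-- Dedekind completeness forces the Archimedean property: the supremum t of the multiples of x
satisfies t + x ≤ t. -/
theorem nonpos_of_nsmul_le {X : Type*} [AddCommGroup X] [ConditionallyCompleteLattice X]
    [IsOrderedAddMonoid X] {x y : X} (h : ∀ n : ℕ, n • x ≤ y) : x ≤ 0 := by
  have hbdd : BddAbove (Set.range fun n : ℕ => n • x) := ⟨y, by rintro _ ⟨n, rfl⟩; exact h n⟩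
  have hlub := isLUB_csSup (Set.range_nonempty _) hbdd
  set t := sSup (Set.range fun n : ℕ => n • x)
  have ht : t ≤ t - x := by
    refine hlub.2 ?_
    rintro _ ⟨n, rfl⟩
    have := hlub.1 ⟨n + 1, rfl⟩
    simp only [succ_nsmul] at this
    exact le_sub_iff_add_le.mpr this
  simpa using ht

theorem nonpos_of_le_inv_smul {X : Type*} [AddCommGroup X] [ConditionallyCompleteLattice X]
    [IsOrderedAddMonoid X] [Module ℝ X] [IsOrderedModule ℝ X] {x y : X} (hy : 0 ≤ y)
    (h : ∀ k : ℕ, x ≤ ((k + 1 : ℕ) : ℝ)⁻¹ • y) : x ≤ 0 := by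
  refine nonpos_of_nsmul_le (y := y) fun n => ?_
  rcases n with _ | k
  · simpa using hy
  · rw [← Nat.cast_smul_eq_nsmul ℝ]
    have h1 := smul_le_smul_of_nonneg_left (h k) (Nat.cast_nonneg (α := ℝ) (k + 1))
    rwa [smul_smul, mul_inv_cancel₀ (by positivity), one_smul] at h1

/-- The component of the unit carried by the band that `u` generates. -/
noncomputable def supp {U : Type*} [CommRing U] [ConditionallyCompleteLattice U] (u : U) : U :=
  sSup (Set.range fun n : ℕ => (n • u) ⊓ 1)

-- Idempotents and level bands in the universal completion

section

variable {E U : Type*}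
  [AddCommGroup E] [Module ℝ E] [ConditionallyCompleteLattice E] [IsOrderedAddMonoid E]
  [IsOrderedModule ℝ E]
  [CommRing U] [Algebra ℝ U] [ConditionallyCompleteLattice U] [IsOrderedRing U]
  [IsOrderedModule ℝ U]

theorem isLUB_supp {u : U} : IsLUB (Set.range fun n : ℕ => (n • u) ⊓ 1) (supp u) :=
  isLUB_csSup (Set.range_nonempty _) ⟨1, by rintro _ ⟨n, rfl⟩; exact inf_le_right⟩

theorem supp_nonneg (u : U) : 0 ≤ supp u := by
  have := (isLUB_supp (u := u)).1 ⟨0, rfl⟩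
  simpa using this

theorem supp_le_one (u : U) : supp u ≤ 1 :=
  isLUB_supp.2 (by rintro _ ⟨n, rfl⟩; exact inf_le_right)

namespace IsUniversalCompletion

variable {ι : E →ₗ[ℝ] U} {e : E} (h : IsUniversalCompletion ι e)
include h

theorem le_iff {a b : E} : ι a ≤ ι b ↔ a ≤ b := by
  rw [← sup_eq_right, ← h.map_sup, h.injective.eq_iff, sup_eq_right]

theorem nonneg_iff {a : E} : 0 ≤ ι a ↔ 0 ≤ a := by
  rw [← h.le_iff, map_zero]

theorem map_inf (a b : E) : ι (a ⊓ b) = ι a ⊓ ι b := by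
  have h1 := congrArg ι (inf_add_sup a b)
  rw [map_add, map_add, h.map_sup, ← inf_add_sup (ι a) (ι b)] at h1
  exact add_right_cancel h1

theorem map_abs (a : E) : ι |a| = |ι a| := by
  simp only [abs, h.map_sup, map_neg]

theorem map_posPart (a : E) : ι a⁺ = (ι a)⁺ := by
  simp only [posPart_def, h.map_sup, map_zero]

theorem mul_eq_zero_of_inf {a b : U} (hab : a ⊓ b = 0) : a * b = 0 := by
  have ha : 0 ≤ a := hab ▸ inf_le_left
  have hb : 0 ≤ b := hab ▸ inf_le_right
  have h1 := h.mul_disjoint a b b hb hab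
  rw [inf_comm] at h1
  have h2 := h.mul_disjoint b (b * a) a ha h1
  rwa [mul_comm b a, inf_idem] at h2

theorem posPart_mul_negPart (a : U) : a⁺ * a⁻ = 0 :=
  h.mul_eq_zero_of_inf (posPart_inf_negPart_eq_zero a)

theorem eq_zero_of_inf_one {x : U} (hx : x ⊓ 1 = 0) : x = 0 := by
  simpa using h.mul_eq_zero_of_inf hx

theorem sq_nonneg' (u : U) : 0 ≤ u * u := by
  have h1 : u * u = u⁺ * u⁺ + u⁻ * u⁻ := by
    conv_lhs => rw [← posPart_sub_negPart u]
    linear_combination (-2) * h.posPart_mul_negPart u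
  rw [h1]
  exact add_nonneg (mul_nonneg (posPart_nonneg _) (posPart_nonneg _))
    (mul_nonneg (negPart_nonneg _) (negPart_nonneg _))

theorem abs_mul_abs' (u : U) : |u| * |u| = u * u := by
  conv_rhs => rw [← posPart_sub_negPart u]
  rw [← posPart_add_negPart u]
  linear_combination 4 * h.posPart_mul_negPart u

/-- The products b u⁺ and b u⁻ are disjoint in an f-algebra, while b u ≤ 0 gives b u⁺ ≤ b u⁻; an
element below one disjoint from it is 0. -/
theorem mul_posPart_of_mul_nonpos {b u : U} (hb : 0 ≤ b) (hbu : b * u ≤ 0) : b * u⁺ = 0 := by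
  have h1 : b * u⁺ ≤ b * u⁻ := by
    refine le_of_sub_eq (neg_nonneg.2 hbu) ?_
    conv_rhs => rw [← posPart_sub_negPart u]
    ring
  have h2 := h.mul_disjoint _ _ b hb (posPart_inf_negPart_eq_zero u)
  rw [inf_comm] at h2
  have h3 := h.mul_disjoint _ _ b hb h2
  rwa [inf_comm, inf_eq_left.2 h1] at h3

theorem mul_inf {a : U} (ha : 0 ≤ a) (b c : U) : a * (b ⊓ c) = (a * b) ⊓ (a * c) := by
  have h0 : (b - b ⊓ c) ⊓ (c - b ⊓ c) = 0 := by
    rw [sub_eq_add_neg, sub_eq_add_neg, ← inf_add, add_neg_cancel]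
  have h2 := h.mul_disjoint _ _ a ha h0
  rw [inf_comm] at h2
  have h3 := h.mul_disjoint _ _ a ha h2
  rw [inf_comm, mul_sub, mul_sub, sub_eq_add_neg, sub_eq_add_neg, ← inf_add,
    ← sub_eq_add_neg, sub_eq_zero] at h3
  exact h3.symm

/-- `E` is an ideal of its universal completion. -/
theorem exists_of_nonneg_of_le {u : U} {x : E} (hu : 0 ≤ u) (hux : u ≤ ι x) : ∃ y, ι y = u := by
  set A : Set E := {y | 0 ≤ y ∧ ι y ≤ u}
  have hlub : IsLUB A (sSup A) := isLUB_csSup ⟨0, le_rfl, by simpa using hu⟩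
    ⟨x, fun y hy => h.le_iff.1 (hy.2.trans hux)⟩
  set s := sSup A
  have hs : ι s ≤ u := by
    by_contra hcon
    have h1 : 0 < (ι s - u)⁺ := by
      refine lt_of_le_of_ne (posPart_nonneg _) fun h0 => hcon ?_
      exact sub_nonpos.1 (posPart_eq_zero.1 h0.symm)
    -- A nonzero piece z of E below the excess (ι s - u)⁺ could be subtracted from s, and s - z
    -- would still bound A, because ι s ⊓ u is ι s minus that excess. If instead ι s falls short of
    -- u, a piece of the gap can be added to s within A.
    obtain ⟨z, hz0, hz⟩ := h.order_dense _ h1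
    have h2 : s ≤ s - z := by
      refine hlub.2 fun y hy => ?_
      rw [← h.le_iff, map_sub]
      have h3 : ι y ≤ ι s ⊓ u := le_inf (h.le_iff.2 (hlub.1 hy)) hy.2
      rw [← sub_posPart_sub] at h3
      exact h3.trans (sub_le_sub_left hz _)
    have h4 : z ≤ 0 := by simpa using h2
    rw [← h.le_iff, map_zero] at h4
    exact absurd h4 (not_le_of_gt hz0)
  refine ⟨s, le_antisymm hs ?_⟩
  by_contra hcon
  have h1 : 0 < u - ι s := lt_of_le_of_ne (sub_nonneg.2 hs) fun h0 => hcon (sub_eq_zero.1 h0.symm).le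
  obtain ⟨z, hz0, hz⟩ := h.order_dense _ h1
  have h0s : 0 ≤ s := hlub.1 ⟨le_rfl, by simpa using hu⟩
  have h2 : s + z ≤ s := hlub.1 ⟨add_nonneg h0s (h.nonneg_iff.1 hz0.le), by
    rw [map_add]; exact add_comm (ι s) (ι z) ▸ le_sub_iff_add_le.1 hz⟩
  have h4 : z ≤ 0 := by simpa using h2
  rw [← h.le_iff, map_zero] at h4
  exact absurd h4 (not_le_of_gt hz0)

theorem exists_of_abs_le {u : U} {x : E} (hux : |u| ≤ ι x) : ∃ y, ι y = u := by
  obtain ⟨y, hy⟩ := h.exists_of_nonneg_of_le (posPart_nonneg u)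
    ((le_add_of_nonneg_right (negPart_nonneg u)).trans ((posPart_add_negPart u).le.trans hux))
  obtain ⟨z, hz⟩ := h.exists_of_nonneg_of_le (negPart_nonneg u)
    ((le_add_of_nonneg_left (posPart_nonneg u)).trans ((posPart_add_negPart u).le.trans hux))
  exact ⟨y - z, by rw [map_sub, hy, hz, posPart_sub_negPart]⟩

theorem mul_le_of_abs_le {c u : U} (hc : 0 ≤ c) : |c * u| ≤ c * |u| := by
  refine sup_le (mul_le_mul_of_nonneg_left (le_abs_self u) hc) ?_
  rw [← mul_neg]
  exact mul_le_mul_of_nonneg_left (neg_le_abs u) hc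

theorem idem_nonneg {b : U} (hb : b * b = b) : 0 ≤ b := hb ▸ h.sq_nonneg' b

theorem idem_compl {b : U} (hb : b * b = b) : (1 - b) * (1 - b) = 1 - b := by
  linear_combination hb

theorem idem_le_one {b : U} (hb : b * b = b) : b ≤ 1 :=
  sub_nonneg.1 (h.idem_nonneg (h.idem_compl hb))

theorem idem_mul_le {b u : U} (hb : b * b = b) (hu : 0 ≤ u) : b * u ≤ u := by
  simpa using mul_le_mul_of_nonneg_right (h.idem_le_one hb) hu

/-- Adding the infimum w to (n u) ⊓ 1 stays below ((n + 1) u) ⊓ 1, so supp u + w ≤ supp u. -/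
theorem compl_supp_inf {u : U} (hu : 0 ≤ u) : (1 - supp u) ⊓ u = 0 := by
  refine le_antisymm ?_ (le_inf (sub_nonneg.2 (supp_le_one u)) hu)
  set w := (1 - supp u) ⊓ u
  have h1 : supp u ≤ supp u - w := by
    refine isLUB_supp.2 ?_
    rintro _ ⟨n, rfl⟩
    have h2 : (n • u) ⊓ 1 + w ≤ ((n + 1) • u) ⊓ 1 := by
      refine le_inf ?_ ?_
      · rw [succ_nsmul]
        exact add_le_add inf_le_left inf_le_right
      · have h3 : (n • u) ⊓ 1 ≤ supp u := isLUB_supp.1 ⟨n, rfl⟩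
        have h4 : w ≤ 1 - supp u := inf_le_left
        exact (add_le_add h3 h4).trans (by simp)
    exact le_sub_iff_add_le.2 (h2.trans (isLUB_supp.1 ⟨n + 1, rfl⟩))
  simpa using h1

theorem supp_mul {u : U} (hu : 0 ≤ u) : supp u * u = u := by
  have := h.mul_eq_zero_of_inf (h.compl_supp_inf hu)
  linear_combination -this

theorem supp_idem {u : U} (hu : 0 ≤ u) : supp u * supp u = supp u := by
  have h0 := supp_nonneg u
  refine le_antisymm ?_ (isLUB_supp.2 ?_)
  · simpa using mul_le_mul_of_nonneg_right (supp_le_one u) h0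
  · rintro _ ⟨n, rfl⟩
    have hn : 0 ≤ (n • u) ⊓ 1 := le_inf (nsmul_nonneg hu n) zero_le_one
    have h1 := h.compl_supp_inf hu
    rw [inf_comm] at h1
    have h2 := h.mul_disjoint _ _ (n : U) (Nat.cast_nonneg n) h1
    rw [← nsmul_eq_mul] at h2
    have h3 : ((n • u) ⊓ 1) ⊓ (1 - supp u) = 0 := by
      refine le_antisymm ?_ (le_inf hn (sub_nonneg.2 (supp_le_one u)))
      rw [← h2]
      exact inf_le_inf_right _ inf_le_left
    have h4 := h.mul_eq_zero_of_inf h3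
    have h5 : (n • u) ⊓ 1 = ((n • u) ⊓ 1) * supp u := by linear_combination h4
    change (n • u) ⊓ 1 ≤ _
    rw [h5]
    exact mul_le_mul_of_nonneg_right (isLUB_supp.1 ⟨n, rfl⟩) h0

/-- Each (n u) ⊓ 1 is disjoint from v, so its sum with v is a join and is at most supp u ⊔ v. Hence
supp u - supp u ⊓ v already bounds all of them. -/
theorem supp_mul_of_inf {u v : U} (huv : u ⊓ v = 0) : supp u * v = 0 := by
  have hu : 0 ≤ u := huv ▸ inf_le_left
  have hv : 0 ≤ v := huv ▸ inf_le_right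
  refine h.mul_eq_zero_of_inf (le_antisymm ?_ (le_inf (supp_nonneg u) hv))
  have h1 : supp u ≤ supp u - supp u ⊓ v := by
    refine isLUB_supp.2 ?_
    rintro _ ⟨n, rfl⟩
    have h2 := h.mul_disjoint _ _ (n : U) (Nat.cast_nonneg n) huv
    rw [← nsmul_eq_mul] at h2
    have h3 : ((n • u) ⊓ 1) ⊓ v = 0 := by
      refine le_antisymm ?_ (le_inf (le_inf (nsmul_nonneg hu n) zero_le_one) hv)
      rw [← h2]
      exact inf_le_inf_right _ inf_le_left
    have h4 := inf_add_sup ((n • u) ⊓ 1) v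
    rw [h3, zero_add] at h4
    have h5 := inf_add_sup (supp u) v
    have h6 : (n • u) ⊓ 1 + v ≤ supp u ⊔ v :=
      h4 ▸ sup_le_sup_right (isLUB_supp.1 ⟨n, rfl⟩) v
    refine le_of_sub_eq (sub_nonneg.2 h6) ?_
    linear_combination -h5
  simpa using h1

theorem supp_posPart_mul (u : U) : supp u⁺ * u = u⁺ := by
  have h1 := h.supp_mul (posPart_nonneg u)
  have h2 := h.supp_mul_of_inf (posPart_inf_negPart_eq_zero u)
  linear_combination h1 - h2 - supp u⁺ * posPart_sub_negPart u

theorem compl_supp_posPart_mul (a : U) (t : U) :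
    (1 - supp (a - t)⁺) * a ≤ (1 - supp (a - t)⁺) * t := by
  refine le_of_sub_eq (negPart_nonneg (a - t)) ?_
  linear_combination h.supp_posPart_mul (a - t) + posPart_sub_negPart (a - t)

/-- Markov's inequality: supp (a - t)⁺ plays the indicator of {a > t}. -/
theorem mul_supp_posPart_le {a t : U} (ha : 0 ≤ a) : t * supp (a - t)⁺ ≤ a := by
  refine le_trans ?_ (h.idem_mul_le (h.supp_idem (posPart_nonneg (a - t))) ha)
  refine le_of_sub_eq (posPart_nonneg (a - t)) ?_
  linear_combination h.supp_posPart_mul (a - t)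

/-- An inequality holds if it holds on each of the bands where `a ≤ N`. -/
theorem nonpos_of_localized {a u : U} (ha : 0 ≤ a)
    (hu : ∀ N : ℕ, (1 - supp (a - N)⁺) * u ≤ 0) : u ≤ 0 := by
  rw [← posPart_eq_zero]
  refine h.eq_zero_of_inf_one (le_antisymm ?_ (le_inf (posPart_nonneg u) zero_le_one))
  -- The part w of u⁺ below 1 vanishes where a ≤ N, so w is at most the component supp (a - N)⁺, and
  -- Markov's inequality gives N w ≤ a for every N.
  refine nonpos_of_nsmul_le (y := a) fun N => ?_
  have hc := h.supp_idem (posPart_nonneg (a - N))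
  have hb := h.idem_nonneg (h.idem_compl hc)
  set w := u⁺ ⊓ 1
  have h1 : (1 - supp (a - N)⁺) * w ≤ 0 := by
    rw [← h.mul_posPart_of_mul_nonpos hb (hu N)]
    exact mul_le_mul_of_nonneg_left inf_le_left hb
  have h2 : supp (a - N)⁺ * w ≤ supp (a - N)⁺ := by
    simpa using mul_le_mul_of_nonneg_left (inf_le_right : w ≤ 1) (h.idem_nonneg hc)
  have h3 : w ≤ supp (a - N)⁺ := by
    refine le_of_sub_eq (add_nonneg (neg_nonneg.2 h1) (sub_nonneg.2 h2)) ?_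
    ring
  rw [nsmul_eq_mul]
  exact (mul_le_mul_of_nonneg_left h3 (Nat.cast_nonneg N)).trans (h.mul_supp_posPart_le ha)

theorem layer_step {v d : U} (hv : 0 ≤ v) (hd : 0 ≤ d) :
    supp (v - d)⁺ * d ≤ v - (v - d)⁺ ∧ v - (v - d)⁺ ≤ supp v * d := by
  rw [sub_posPart_sub]
  refine ⟨le_inf ?_ (h.idem_mul_le (h.supp_idem (posPart_nonneg _)) hd), ?_⟩
  · rw [mul_comm]
    exact h.mul_supp_posPart_le hv
  · have h1 : (1 - supp v) * (v ⊓ d) ≤ (1 - supp v) * v :=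
      mul_le_mul_of_nonneg_left inf_le_left (sub_nonneg.2 (supp_le_one v))
    have h2 : supp v * (v ⊓ d) ≤ supp v * d :=
      mul_le_mul_of_nonneg_left inf_le_right (supp_nonneg v)
    refine le_of_sub_eq (add_nonneg (sub_nonneg.2 h1) (sub_nonneg.2 h2)) ?_
    linear_combination h.supp_mul hv

/-- Telescoping of `layer_step`. The upper sum is the lower one moved by one level, so the two
differ only in the end layers; the bottom one is enlarged to the whole of d. -/
theorem layer_sum {g d : U} (hg : 0 ≤ g) (hd : 0 ≤ d) (N : ℕ) :
    ∑ i ∈ Finset.range N, supp (g - (i + 1) • d)⁺ * d ≤ g - (g - N • d)⁺ ∧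
    g - (g - N • d)⁺ ≤
      ∑ i ∈ Finset.range N, supp (g - (i + 1) • d)⁺ * d + (d - supp (g - N • d)⁺ * d) := by
  induction N with
  | zero =>
    simp only [Finset.range_zero, Finset.sum_empty, zero_smul, sub_zero, zero_add,
      posPart_of_nonneg hg, sub_self, le_refl, true_and]
    exact sub_nonneg.2 (h.idem_mul_le (h.supp_idem hg) hd)
  | succ N ih =>
    have h1 := h.layer_step (posPart_nonneg (g - N • d)) hd
    have h2 : ((g - N • d)⁺ - d)⁺ = (g - (N + 1) • d)⁺ := by
      rw [posPart_sub_of_nonneg _ hd, succ_nsmul, sub_sub]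
    rw [h2] at h1
    rw [Finset.sum_range_succ]
    constructor
    · refine le_of_sub_eq (add_nonneg (sub_nonneg.2 ih.1) (sub_nonneg.2 h1.1)) ?_
      ring
    · refine le_of_sub_eq (add_nonneg (sub_nonneg.2 ih.2) (sub_nonneg.2 h1.2)) ?_
      ring

/-- Approximation of `g` by the sum of its level bands at the heights `d, 2 d, …, N d`. -/
theorem layer_cake {g d : U} (hg : 0 ≤ g) (hd : 0 ≤ d) {N : ℕ} (hgN : g ≤ N • d) :
    0 ≤ g - ∑ i ∈ Finset.range N, supp (g - (i + 1) • d)⁺ * d ∧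
    g - ∑ i ∈ Finset.range N, supp (g - (i + 1) • d)⁺ * d ≤ d := by
  have h1 := h.layer_sum hg hd N
  rw [posPart_eq_zero.2 (sub_nonpos.2 hgN), sub_zero] at h1
  refine ⟨sub_nonneg.2 h1.1, ?_⟩
  rw [sub_le_iff_le_add']
  refine h1.2.trans (add_le_add_right (sub_le_self _ (mul_nonneg (supp_nonneg _) hd)) _)

theorem exists_idem_mul {b : U} (hb : b * b = b) (x : E) : ∃ y, ι y = b * ι x := by
  refine h.exists_of_abs_le (x := |x|) ?_
  rw [h.map_abs]
  exact (h.mul_le_of_abs_le (h.idem_nonneg hb)).trans (h.idem_mul_le hb (abs_nonneg _))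

/-- The band projection given by multiplication by an idempotent. -/
noncomputable def bandMul {b : U} (hb : b * b = b) : E →ₗ[ℝ] E where
  toFun x := (h.exists_idem_mul hb x).choose
  map_add' x y := by
    refine h.injective ((h.exists_idem_mul hb (x + y)).choose_spec.trans ?_)
    rw [map_add ι x y, mul_add]
    exact ((map_add ι _ _).trans (congrArg₂ (· + ·) (h.exists_idem_mul hb x).choose_spec
      (h.exists_idem_mul hb y).choose_spec)).symm
  map_smul' r x := by
    refine h.injective ((h.exists_idem_mul hb (r • x)).choose_spec.trans ?_)
    rw [map_smul ι r x, mul_smul_comm]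
    exact ((map_smul ι _ _).trans (congrArg (r • ·) (h.exists_idem_mul hb x).choose_spec)).symm

theorem map_bandMul {b : U} (hb : b * b = b) (x : E) : ι (h.bandMul hb x) = b * ι x :=
  (h.exists_idem_mul hb x).choose_spec

theorem bandMul_nonneg {b : U} (hb : b * b = b) {x : E} (hx : 0 ≤ x) : 0 ≤ h.bandMul hb x := by
  rw [← h.nonneg_iff, h.map_bandMul]
  exact mul_nonneg (h.idem_nonneg hb) (h.nonneg_iff.2 hx)

theorem bandMul_le {b : U} (hb : b * b = b) {x : E} (hx : 0 ≤ x) : h.bandMul hb x ≤ x := by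
  rw [← h.le_iff, h.map_bandMul]
  exact h.idem_mul_le hb (h.nonneg_iff.2 hx)

theorem isBandProjection_bandMul {b : U} (hb : b * b = b) : IsBandProjection (h.bandMul hb) := by
  refine ⟨fun x => h.injective ?_, fun x hx => ⟨h.bandMul_nonneg hb hx, h.bandMul_le hb hx⟩⟩
  rw [h.map_bandMul, h.map_bandMul, ← mul_assoc, hb]

theorem map_bandMul_unit {b : U} (hb : b * b = b) : ι (h.bandMul hb e) = b := by
  rw [h.map_bandMul, h.map_unit, mul_one]

theorem bandMul_compl {b : U} (hb : b * b = b) (x : E) :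
    h.bandMul (h.idem_compl hb) x = x - h.bandMul hb x := by
  apply h.injective
  rw [map_sub, h.map_bandMul, h.map_bandMul]
  ring

theorem unit_nonneg : 0 ≤ e := by
  rw [← h.nonneg_iff, h.map_unit]
  exact zero_le_one

/-- On the band where x ≤ N the N-th member of the family is already 0. With order continuity, this
extends identities from bounded elements to all of E. -/
theorem isGLB_posPart_sub {x : E} (hx : 0 ≤ x) :
    IsGLB (Set.range fun n : ℕ => (x - n • e)⁺) 0 := by
  refine ⟨by rintro _ ⟨n, rfl⟩; exact posPart_nonneg _, fun w hw => ?_⟩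
  rw [← h.le_iff, map_zero]
  refine h.nonpos_of_localized (h.nonneg_iff.2 hx) fun N => ?_
  have h1 : ι w ≤ (ι x - N)⁺ := by
    have := h.le_iff.2 (hw ⟨N, rfl⟩)
    simpa [h.map_posPart, h.map_unit] using this
  have hc := h.supp_idem (posPart_nonneg (ι x - N))
  refine (mul_le_mul_of_nonneg_left h1 (h.idem_nonneg (h.idem_compl hc))).trans_eq ?_
  linear_combination -(h.supp_mul (posPart_nonneg (ι x - N)))

end IsUniversalCompletion

end

-- Conditional expectation operators: measurable bands, averaging, Jensen, tower

section

variable {E U : Type*}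
  [AddCommGroup E] [Module ℝ E] [ConditionallyCompleteLattice E] [IsOrderedAddMonoid E]
  [IsOrderedModule ℝ E]
  [CommRing U] [Algebra ℝ U] [ConditionallyCompleteLattice U] [IsOrderedRing U]
  [IsOrderedModule ℝ U]

namespace IsCondExp

variable {V : E →ₗ[ℝ] E} (hV : IsCondExp V)
include hV

theorem mono {x y : E} (hxy : x ≤ y) : V x ≤ V y := by
  have := hV.map_nonneg _ (sub_nonneg.2 hxy)
  rwa [map_sub, sub_nonneg] at this

theorem abs_map_le (x : E) : |V x| ≤ V |x| :=
  sup_le (hV.mono (le_abs_self x)) (by rw [← map_neg]; exact hV.mono (neg_le_abs x))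

theorem apply_of_mem {x : E} (hx : x ∈ Set.range V) : V x = x := by
  obtain ⟨y, rfl⟩ := hx
  exact hV.idem y

theorem abs_mem {x : E} (hx : x ∈ Set.range V) : |x| ∈ Set.range V :=
  hV.range_sup _ _ hx (by obtain ⟨y, rfl⟩ := hx; exact ⟨-y, map_neg _ _⟩)

theorem posPart_mem {x : E} (hx : x ∈ Set.range V) : x⁺ ∈ Set.range V :=
  hV.range_sup _ _ hx ⟨0, map_zero _⟩

/-- Closing A under finite joins makes the differences a - y directed downwards to 0. Order
continuity then shows that V a is also the supremum, so V a = a. -/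
theorem isLUB_mem {A : Set E} (hA : A.Nonempty) (hAV : A ⊆ Set.range V) {a : E}
    (ha : IsLUB A a) : a ∈ Set.range V := by
  have hclosed : SupClosed (Set.range V) := fun x hx y hy => hV.range_sup x y hx hy
  have hsub : supClosure A ⊆ Set.range V := supClosure_min hAV hclosed
  have ha' : IsLUB (supClosure A) a := isLUB_supClosure.2 ha
  have hne : (supClosure A).Nonempty := hA.mono subset_supClosure
  have hglb : IsGLB ((fun y => a - y) '' supClosure A) 0 := by
    refine ⟨?_, fun w hw => ?_⟩
    · rintro _ ⟨y, hy, rfl⟩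
      exact sub_nonneg.2 (ha'.1 hy)
    · have : a ≤ a - w := ha'.2 fun y hy => le_sub_comm.1 (hw ⟨y, hy, rfl⟩)
      simpa using this
  have hdir : DirectedOn (· ≥ ·) ((fun y => a - y) '' supClosure A) := by
    rintro _ ⟨y, hy, rfl⟩ _ ⟨z, hz, rfl⟩
    exact ⟨_, ⟨y ⊔ z, supClosed_supClosure hy hz, rfl⟩,
      sub_le_sub_left le_sup_left a, sub_le_sub_left le_sup_right a⟩
  have h1 := hV.order_continuous _ (hne.image _) hdir hglb
  have h2 : IsLUB (supClosure A) (V a) := by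
    have hval : ∀ y ∈ supClosure A, V (a - y) = V a - y := fun y hy => by
      rw [map_sub, hV.apply_of_mem (hsub hy)]
    refine ⟨fun y hy => ?_, fun w hw => ?_⟩
    · have := h1.1 ⟨_, ⟨y, hy, rfl⟩, rfl⟩
      rwa [hval y hy, sub_nonneg] at this
    · refine sub_nonpos.1 (h1.2 ?_)
      rintro _ ⟨_, ⟨y, hy, rfl⟩, rfl⟩
      change _ ≤ V (a - y)
      rw [hval y hy]
      exact sub_le_sub_left (hw hy) _
  exact ⟨a, h2.unique ha'⟩

theorem isGLB_mem {A : Set E} (hA : A.Nonempty) (hAV : A ⊆ Set.range V) {a : E}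
    (ha : IsGLB A a) : a ∈ Set.range V := by
  have h1 : IsLUB (-A) (-a) := by rwa [isLUB_neg, neg_neg]
  obtain ⟨y, hy⟩ := hV.isLUB_mem hA.neg (fun x hx => by
    obtain ⟨y, hy⟩ := hAV hx
    exact ⟨-y, by rw [map_neg, hy, neg_neg]⟩) h1
  exact ⟨-y, by rw [map_neg, hy, neg_neg]⟩

variable {ι : E →ₗ[ℝ] U} {e : E} (h : IsUniversalCompletion ι e)
include h

/-- For x ≤ n e, positivity bounds V of the c-part of x by n times the component c, which b
annihilates. In general only the contribution of (x - n e)⁺ survives, and its image under V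
decreases to 0. -/
theorem bandMul_map_bandMul_eq_zero {b c : U} (hb : b * b = b) (hc : c * c = c) (hbc : b * c = 0)
    (hcV : h.bandMul hc e ∈ Set.range V) {x : E} (hx : 0 ≤ x) :
    h.bandMul hb (V (h.bandMul hc x)) = 0 := by
  have hmono : ∀ {u v : E}, u ≤ v →
      h.bandMul hb (V (h.bandMul hc u)) ≤ h.bandMul hb (V (h.bandMul hc v)) := by
    intro u v huv
    rw [← sub_nonneg, ← map_sub, ← map_sub, ← map_sub]
    exact h.bandMul_nonneg hb (hV.map_nonneg _ (h.bandMul_nonneg hc (sub_nonneg.2 huv)))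
  refine le_antisymm ?_ (h.bandMul_nonneg hb (hV.map_nonneg _ (h.bandMul_nonneg hc hx)))
  have hdir : DirectedOn (· ≥ ·) (Set.range fun n : ℕ => (x - n • e)⁺) := by
    rintro _ ⟨n, rfl⟩ _ ⟨m, rfl⟩
    refine ⟨_, ⟨n + m, rfl⟩, posPart_mono ?_, posPart_mono ?_⟩
    · exact sub_le_sub_left (nsmul_le_nsmul_left h.unit_nonneg (Nat.le_add_right n m)) x
    · exact sub_le_sub_left (nsmul_le_nsmul_left h.unit_nonneg (Nat.le_add_left m n)) x
  have hglb := hV.order_continuous _ (Set.range_nonempty _) hdir (h.isGLB_posPart_sub hx)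
  refine hglb.2 ?_
  rintro _ ⟨_, ⟨n, rfl⟩, rfl⟩
  have h1 : x ≤ n • e + (x - n • e)⁺ := by
    rw [← sub_le_iff_le_add']
    exact le_posPart _
  have h2 := hmono h1
  have h3 : h.bandMul hb (V (h.bandMul hc e)) = 0 := by
    rw [hV.apply_of_mem hcV]
    apply h.injective
    rw [h.map_bandMul, h.map_bandMul, ← mul_assoc, hbc, zero_mul, map_zero]
  rw [map_add, map_add, map_add, map_nsmul, map_nsmul, map_nsmul, h3, smul_zero, zero_add] at h2
  have h4 : 0 ≤ (x - n • e)⁺ := posPart_nonneg _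
  refine h2.trans ((h.bandMul_le hb (hV.map_nonneg _ (h.bandMul_nonneg hc h4))).trans ?_)
  exact hV.mono (h.bandMul_le hc h4)

theorem compl_mem (hVe : V e = e) {b : U} (hb : b * b = b)
    (hbV : h.bandMul hb e ∈ Set.range V) : h.bandMul (h.idem_compl hb) e ∈ Set.range V := by
  obtain ⟨y, hy⟩ := hbV
  exact ⟨e - y, by rw [h.bandMul_compl, map_sub, hy, hVe]⟩

/-- A conditional expectation operator commutes with the band projections measurable for it. -/
theorem map_bandMul_comm (hVe : V e = e) {b : U} (hb : b * b = b)
    (hbV : h.bandMul hb e ∈ Set.range V) (x : E) :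
    V (h.bandMul hb x) = h.bandMul hb (V x) := by
  have key : ∀ x, 0 ≤ x → V (h.bandMul hb x) = h.bandMul hb (V x) := by
    intro x hx
    have hbc : b * (1 - b) = 0 := by linear_combination -hb
    -- Nothing leaks from the complementary band into b, nor from b into its complement.
    have h1 := hV.bandMul_map_bandMul_eq_zero h hb (h.idem_compl hb) hbc
      (hV.compl_mem h hVe hb hbV) hx
    have h2 := hV.bandMul_map_bandMul_eq_zero h (h.idem_compl hb) hb
      (by rw [mul_comm, hbc]) hbV hx
    rw [h.bandMul_compl hb, sub_eq_zero] at h2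
    rw [h.bandMul_compl hb, map_sub, map_sub, sub_eq_zero] at h1
    rw [h1, h2.symm]
  rw [← posPart_sub_negPart x]
  simp only [map_sub, key _ (posPart_nonneg x), key _ (negPart_nonneg x)]

theorem bandMul_mem (hVe : V e = e) {b : U} (hb : b * b = b)
    (hbV : h.bandMul hb e ∈ Set.range V) {x : E} (hx : x ∈ Set.range V) :
    h.bandMul hb x ∈ Set.range V :=
  ⟨h.bandMul hb x, by rw [hV.map_bandMul_comm h hVe hb hbV, hV.apply_of_mem hx]⟩

/-- The component is the supremum of the measurable elements (n x) ⊓ e. Keeping b separate from supp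
(ι x) lets the same idempotent be written in other forms. -/
theorem supp_mem (hVe : V e = e) {x : E} (hx : x ∈ Set.range V) {b : U} (hb : b * b = b)
    (hbx : b = supp (ι x)) (hx0 : 0 ≤ x) : h.bandMul hb e ∈ Set.range V := by
  refine hV.isLUB_mem (A := Set.range fun n : ℕ => (n • x) ⊓ e) (Set.range_nonempty _) ?_ ?_
  · rintro _ ⟨n, rfl⟩
    refine hV.range_inf _ _ ?_ ⟨e, hVe⟩
    obtain ⟨y, rfl⟩ := hx
    exact ⟨n • y, map_nsmul _ _ _⟩
  · have hlub := isLUB_supp (u := ι x)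
    have hval : ∀ n : ℕ, ι ((n • x) ⊓ e) = (n • ι x) ⊓ 1 := fun n => by
      rw [h.map_inf, map_nsmul, h.map_unit]
    refine ⟨?_, fun w hw => ?_⟩
    · rintro _ ⟨n, rfl⟩
      rw [← h.le_iff, h.map_bandMul_unit, hbx, hval]
      exact hlub.1 ⟨n, rfl⟩
    · rw [← h.le_iff, h.map_bandMul_unit, hbx]
      refine hlub.2 ?_
      rintro _ ⟨n, rfl⟩
      change (n • ι x) ⊓ 1 ≤ _
      rw [← hval, h.le_iff]
      exact hw ⟨n, rfl⟩

theorem cut_mem (hVe : V e = e) {a : E} (ha : a ∈ Set.range V) (N : ℕ) :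
    h.bandMul (h.idem_compl (h.supp_idem (posPart_nonneg (ι a - N)))) e ∈ Set.range V := by
  have hb := h.supp_idem (posPart_nonneg (ι a - N))
  refine hV.compl_mem h hVe hb (hV.supp_mem h hVe (x := (a - N • e)⁺) (hV.posPart_mem ?_) hb ?_
    (posPart_nonneg _))
  · obtain ⟨y, rfl⟩ := ha
    exact ⟨y - N • e, by rw [map_sub, map_nsmul, hVe]⟩
  · rw [h.map_posPart, map_sub, map_nsmul, h.map_unit, nsmul_one]

/-- Approximation of `g` by combinations of measurable components. -/
theorem exists_layers (hVe : V e = e) {g d : E} (hg : g ∈ Set.range V) (hd : d ∈ Set.range V)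
    (hg0 : 0 ≤ g) (hd0 : 0 ≤ d) {N : ℕ} (hgd : g ≤ N • d) :
    ∃ (q : ℕ → U) (hq : ∀ i, q i * q i = q i), (∀ i, h.bandMul (hq i) e ∈ Set.range V) ∧
      0 ≤ ι g - ∑ i ∈ Finset.range N, q i * ι d ∧
      ι g - ∑ i ∈ Finset.range N, q i * ι d ≤ ι d := by
  refine ⟨fun i => supp (ι g - (i + 1) • ι d)⁺, fun i => h.supp_idem (posPart_nonneg _),
    fun i => ?_, h.layer_cake (h.nonneg_iff.2 hg0) (h.nonneg_iff.2 hd0) ?_⟩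
  · refine hV.supp_mem h hVe (x := (g - (i + 1) • d)⁺) (hV.posPart_mem ?_) _ ?_ (posPart_nonneg _)
    · obtain ⟨y, rfl⟩ := hg
      obtain ⟨z, rfl⟩ := hd
      exact ⟨y - (i + 1) • z, by rw [map_sub, map_nsmul]⟩
    · rw [h.map_posPart, map_sub, map_nsmul]
  · rw [← map_nsmul, h.le_iff]
    exact hgd

theorem averaging_of_le (hVe : V e = e) {a x z : E} {N : ℕ} (ha : a ∈ Set.range V) (ha0 : 0 ≤ a)
    (haN : a ≤ N • e) (hx : 0 ≤ x) (hz : ι z = ι a * ι x) : ι (V z) = ι a * ι (V x) := by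
  have hVx : 0 ≤ ι (V x) := h.nonneg_iff.2 (hV.map_nonneg _ hx)
  have hx' : 0 ≤ ι x := h.nonneg_iff.2 hx
  -- With a replaced by a layer sum of mesh N/(k+1), V commutes with each band. The resulting s lies
  -- below both V (a x) and a V x, within N/(k+1) times V x of each.
  have key : ∀ k : ℕ, ∃ s : U, (0 ≤ ι (V z) - s ∧
      ι (V z) - s ≤ ((k + 1 : ℕ) : ℝ)⁻¹ • ((N : ℝ) • ι (V x))) ∧
      (0 ≤ ι a * ι (V x) - s ∧
      ι a * ι (V x) - s ≤ ((k + 1 : ℕ) : ℝ)⁻¹ • ((N : ℝ) • ι (V x))) := by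
    intro k
    have hc : (0 : ℝ) ≤ ((k + 1 : ℕ) : ℝ)⁻¹ * N := by positivity
    set c : ℝ := ((k + 1 : ℕ) : ℝ)⁻¹ * N with hcdef
    obtain ⟨q, hq, hqV, hl, hu⟩ := hV.exists_layers h hVe (g := a) (d := c • e) (N := k + 1) ha
      ⟨c • e, by rw [map_smul, hVe]⟩ ha0 (smul_nonneg hc h.unit_nonneg) (by
        refine haN.trans_eq ?_
        rw [← Nat.cast_smul_eq_nsmul ℝ, ← Nat.cast_smul_eq_nsmul ℝ (k + 1), smul_smul, hcdef,
          mul_inv_cancel_left₀ (by positivity)])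
    rw [map_smul, h.map_unit] at hl hu
    have hsum : ∀ w : E, ι (∑ i ∈ Finset.range (k + 1), h.bandMul (hq i) (c • w)) =
        (∑ i ∈ Finset.range (k + 1), q i * c • (1 : U)) * ι w := by
      intro w
      rw [map_sum, Finset.sum_mul]
      refine Finset.sum_congr rfl fun i _ => ?_
      rw [h.map_bandMul, map_smul, mul_assoc, smul_mul_assoc, one_mul]
    have hV' : V (∑ i ∈ Finset.range (k + 1), h.bandMul (hq i) (c • x)) =
        ∑ i ∈ Finset.range (k + 1), h.bandMul (hq i) (c • V x) := by
      rw [map_sum]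
      refine Finset.sum_congr rfl fun i _ => ?_
      rw [hV.map_bandMul_comm h hVe (hq i) (hqV i), map_smul]
    have hmul : ∀ w : E, 0 ≤ ι w →
        0 ≤ ι a * ι w - ι (∑ i ∈ Finset.range (k + 1), h.bandMul (hq i) (c • w)) ∧
        ι a * ι w - ι (∑ i ∈ Finset.range (k + 1), h.bandMul (hq i) (c • w)) ≤ ι (c • w) := by
      intro w hw
      rw [hsum, ← sub_mul]
      refine ⟨mul_nonneg hl hw, (mul_le_mul_of_nonneg_right hu hw).trans_eq ?_⟩
      rw [smul_mul_assoc, one_mul, map_smul]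
    have h1 := hmul x hx'
    have h2 := hmul (V x) hVx
    rw [← hz, ← map_sub, h.nonneg_iff, h.le_iff] at h1
    have h3 := hV.map_nonneg _ h1.1
    have h4 := hV.mono h1.2
    rw [map_sub, hV'] at h3 h4
    rw [← h.nonneg_iff, map_sub] at h3
    rw [← h.le_iff, map_sub, map_smul] at h4
    rw [smul_smul, ← hcdef]
    rw [map_smul ι c (V x)] at h2
    rw [map_smul ι c (V x)] at h4
    exact ⟨_, ⟨h3, h4⟩, h2⟩
  have hN : 0 ≤ (N : ℝ) • ι (V x) := smul_nonneg (Nat.cast_nonneg N) hVx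
  refine le_antisymm (sub_nonpos.1 ?_) (sub_nonpos.1 ?_)
  · refine nonpos_of_le_inv_smul hN fun k => ?_
    obtain ⟨s, ⟨_, h2⟩, h3, _⟩ := key k
    refine le_trans (le_of_sub_eq h3 ?_) h2
    ring
  · refine nonpos_of_le_inv_smul hN fun k => ?_
    obtain ⟨s, ⟨h1, _⟩, _, h4⟩ := key k
    refine le_trans (le_of_sub_eq h1 ?_) h4
    ring

theorem cut_bounds (hVe : V e = e) {a : E} (ha : a ∈ Set.range V) (ha0 : 0 ≤ a) (N : ℕ) :
    h.bandMul (h.idem_compl (h.supp_idem (posPart_nonneg (ι a - N)))) a ∈ Set.range V ∧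
    0 ≤ h.bandMul (h.idem_compl (h.supp_idem (posPart_nonneg (ι a - N)))) a ∧
    h.bandMul (h.idem_compl (h.supp_idem (posPart_nonneg (ι a - N)))) a ≤ N • e := by
  refine ⟨hV.bandMul_mem h hVe _ (hV.cut_mem h hVe ha N) ha, h.bandMul_nonneg _ ha0, ?_⟩
  rw [← h.le_iff, h.map_bandMul, map_nsmul, h.map_unit, nsmul_one]
  refine (h.compl_supp_posPart_mul _ _).trans (h.idem_mul_le (h.idem_compl (h.supp_idem ?_)) ?_)
  · exact posPart_nonneg _
  · exact Nat.cast_nonneg N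

/-- The averaging property of conditional expectation operators. -/
theorem averaging (hVe : V e = e) {a x z : E} (ha : a ∈ Set.range V) (ha0 : 0 ≤ a)
    (hx : 0 ≤ x) (hz : ι z = ι a * ι x) : ι (V z) = ι a * ι (V x) := by
  have key : ∀ N : ℕ, (1 - supp (ι a - N)⁺) * (ι (V z) - ι a * ι (V x)) = 0 := by
    intro N
    obtain ⟨h1, h2, h3⟩ := hV.cut_bounds h hVe ha ha0 N
    set hb := h.idem_compl (h.supp_idem (posPart_nonneg (ι a - N)))
    have h4 := hV.averaging_of_le h hVe h1 h2 h3 hx (z := h.bandMul hb z) (by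
      rw [h.map_bandMul, h.map_bandMul, hz, mul_assoc])
    rw [hV.map_bandMul_comm h hVe hb (hV.cut_mem h hVe ha N), h.map_bandMul, h.map_bandMul] at h4
    linear_combination h4
  have ha' := h.nonneg_iff.2 ha0
  refine le_antisymm (sub_nonpos.1 (h.nonpos_of_localized ha' fun N => (key N).le))
    (sub_nonpos.1 (h.nonpos_of_localized ha' fun N => ?_))
  exact le_of_eq (by linear_combination -(key N))

/-- The conditional Jensen inequality for the square. -/
theorem sq_map_le (hVe : V e = e) {x z : E} (hx : 0 ≤ x) (hz : ι z = ι x * ι x) :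
    ι (V x) * ι (V x) ≤ ι (V z) := by
  have hVx := hV.map_nonneg _ hx
  refine sub_nonpos.1 (h.nonpos_of_localized (h.nonneg_iff.2 hVx) fun N => ?_)
  obtain ⟨h1, h2, h3⟩ := hV.cut_bounds h hVe ⟨x, rfl⟩ hVx N
  set hb := h.idem_compl (h.supp_idem (posPart_nonneg (ι (V x) - N)))
  set y := h.bandMul hb (V x) with hy
  have hiy : ι y = (1 - supp (ι (V x) - N)⁺) * ι (V x) := h.map_bandMul hb _
  have hprod : ∀ w : E, 0 ≤ w → ∃ v, ι v = ι y * ι w := by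
    intro w hw
    have hw' := h.nonneg_iff.2 hw
    refine h.exists_of_nonneg_of_le (x := N • w) (mul_nonneg (h.nonneg_iff.2 h2) hw') ?_
    rw [map_nsmul, nsmul_eq_mul]
    refine mul_le_mul_of_nonneg_right ?_ hw'
    have := h.le_iff.2 h3
    rwa [map_nsmul, h.map_unit, nsmul_one] at this
  obtain ⟨w, hw⟩ := hprod x hx
  obtain ⟨v, hv⟩ := hprod y h2
  have hw' := hV.averaging h hVe h1 h2 hx hw
  have hv' := hV.averaging h hVe h1 h2 h2 hv
  rw [hV.apply_of_mem h1] at hv'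
  -- This is (x - y)² ≥ 0 with y the truncation of V x. Applying V and averaging gives V z - 2 y V x
  -- + y² ≥ 0, and on the band V x ≤ N, y equals V x.
  have h4 : 0 ≤ z - w - w + v := by
    rw [← h.nonneg_iff, map_add, map_sub, map_sub, hz, hw, hv]
    refine (h.sq_nonneg' (ι x - ι y)).trans_eq ?_
    ring
  have h5 := h.nonneg_iff.2 (hV.map_nonneg _ h4)
  rw [map_add, map_sub, map_sub, map_add, map_sub, map_sub, hw', hv', hiy] at h5
  have hbi : (1 - supp (ι (V x) - N)⁺) * (1 - supp (ι (V x) - N)⁺) = 1 - supp (ι (V x) - N)⁺ := hb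
  generalize 1 - supp (ι (V x) - N)⁺ = b at hbi h5 ⊢
  have h6 := mul_nonneg (h.idem_nonneg hbi) h5
  refine le_of_sub_eq h6 ?_
  linear_combination (-(2 : U) * ι (V x) * ι (V x) + (b + 1) * ι (V x) * ι (V x)) * -hbi

omit hV in
/-- Conditional expectation operators compatible with the strictly positive `T` satisfy the tower
property. -/
theorem tower {T V W : E →ₗ[ℝ] E} (hT : IsStrictlyPositive T) (hV : IsCondExp V)
    (hW : IsCondExp W) (hVT : IsCompatible V T) (hWT : IsCompatible W T) (hVe : V e = e)
    (hWe : W e = e) (hVW : Set.range V ⊆ Set.range W) (x : E) : V (W x) = V x := by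
  have key : ∀ x, V (W x) ≤ V x := by
    intro x
    have hm : (V (W x - x))⁺ ∈ Set.range V := hV.posPart_mem ⟨_, rfl⟩
    have hb := h.supp_idem (h.nonneg_iff.2 (posPart_nonneg (V (W x - x))))
    have hbV := hV.supp_mem h hVe hm hb rfl (posPart_nonneg _)
    have h1 : h.bandMul hb (V (W x - x)) = (V (W x - x))⁺ := by
      apply h.injective
      rw [h.map_bandMul, h.map_posPart, h.supp_posPart_mul]
    -- The band is measurable for V, hence for W; it passes through both operators, and T absorbs V
    -- and W, leaving a difference of equal terms.
    have h2 : T (V (W x - x))⁺ = 0 := by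
      rw [← h1, ← hV.map_bandMul_comm h hVe hb hbV, hVT.2, map_sub,
        ← hW.map_bandMul_comm h hWe hb (hVW hbV), map_sub, hWT.2, sub_self]
    have h3 : (V (W x - x))⁺ = 0 := by
      by_contra hne
      exact (hT _ (lt_of_le_of_ne (posPart_nonneg _) (Ne.symm hne))).ne' h2
    rw [posPart_eq_zero, map_sub, sub_nonpos] at h3
    exact h3
  refine le_antisymm (key x) ?_
  have := key (-x)
  rwa [map_neg, map_neg, map_neg, neg_le_neg_iff] at this

end IsCondExp

end

-- Mixing coefficients and mixing inequalities

section

variable {E U : Type*}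
  [AddCommGroup E] [Module ℝ E] [ConditionallyCompleteLattice E] [IsOrderedAddMonoid E]
  [IsOrderedModule ℝ E]
  [CommRing U] [Algebra ℝ U] [ConditionallyCompleteLattice U] [IsOrderedRing U]
  [IsOrderedModule ℝ U]

theorem abs_sub_le_of_mem_Icc {x y u : E} (hx0 : 0 ≤ x) (hx : x ≤ u) (hy0 : 0 ≤ y) (hy : y ≤ u) :
    |x - y| ≤ u :=
  sup_le ((sub_le_self x hy0).trans hx) ((neg_sub x y).le.trans ((sub_le_self y hx0).trans hy))

theorem zero_mem_bandProjections (e : E) (S : E →ₗ[ℝ] E) : 0 ∈ bandProjections e S :=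
  ⟨⟨fun _ => rfl, fun _ hx => ⟨le_rfl, hx⟩⟩, 0, map_zero S⟩

variable {ι : E →ₗ[ℝ] U} {e : E} {T : E →ₗ[ℝ] E}

theorem IsUniversalCompletion.exists_mul_of_le_unit (h : IsUniversalCompletion ι e) {x y : E}
    (hx : 0 ≤ x) (hy0 : 0 ≤ y) (hy : y ≤ e) : ∃ z, 0 ≤ z ∧ z ≤ x ∧ ι z = ι x * ι y := by
  have h0 := mul_nonneg (h.nonneg_iff.2 hx) (h.nonneg_iff.2 hy0)
  have h1 : ι x * ι y ≤ ι x := by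
    have := mul_le_mul_of_nonneg_left (h.le_iff.2 hy) (h.nonneg_iff.2 hx)
    rwa [h.map_unit, mul_one] at this
  obtain ⟨z, hz⟩ := h.exists_of_nonneg_of_le h0 h1
  exact ⟨z, h.nonneg_iff.1 (hz ▸ h0), h.le_iff.1 (hz ▸ h1), hz⟩

theorem isGLB_condNorm_top {f : E} (hf : f ∈ Lp ι T .top) :
    IsGLB {g | g ∈ Set.range T ∧ 0 ≤ g ∧ |f| ≤ g} (condNorm ι T .top f) := by
  obtain ⟨g, hg, hg0, hfg⟩ := hf
  exact isGLB_csInf ⟨g, hg, hg0, hfg⟩ ⟨0, fun x hx => hx.2.1⟩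

theorem condNorm_top_nonneg {f : E} (hf : f ∈ Lp ι T .top) : 0 ≤ condNorm ι T .top f :=
  (isGLB_condNorm_top hf).2 fun _ hx => hx.2.1

theorem abs_le_condNorm_top {f : E} (hf : f ∈ Lp ι T .top) : |f| ≤ condNorm ι T .top f :=
  (isGLB_condNorm_top hf).2 fun _ hx => hx.2.2

theorem condNorm_top_le {f g : E} (hg : g ∈ Set.range T) (hfg : |f| ≤ g) :
    condNorm ι T .top f ≤ g := by
  have hf : f ∈ Lp ι T .top := ⟨g, hg, (abs_nonneg f).trans hfg, hfg⟩
  have hmem : g ∈ {g | g ∈ Set.range T ∧ 0 ≤ g ∧ |f| ≤ g} := ⟨hg, (abs_nonneg f).trans hfg, hfg⟩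
  exact (isGLB_condNorm_top hf).1 hmem

theorem IsCondExp.condNorm_top_mem (hT : IsCondExp T) {f : E} (hf : f ∈ Lp ι T .top) :
    condNorm ι T .top f ∈ Set.range T := by
  obtain ⟨g, hg, hg0, hfg⟩ := id hf
  refine hT.isGLB_mem ?_ (fun x hx => ?_) (isGLB_condNorm_top hf)
  exacts [⟨g, hg, hg0, hfg⟩, hx.1]

theorem IsCondExp.map_mem_Icc (hT : IsCondExp T) (hTe : T e = e) {x : E} (hx0 : 0 ≤ x)
    (hx : x ≤ e) : 0 ≤ T x ∧ T x ≤ e :=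
  ⟨hT.map_nonneg x hx0, (hT.mono hx).trans_eq hTe⟩

/-- A supremum of elements of `[0, e]` in the range of `T` is of the same kind. -/
theorem IsCondExp.csSup_mem (hT : IsCondExp T) {A : Set E} (hne : A.Nonempty)
    (hA : ∀ x ∈ A, x ∈ Set.range T ∧ 0 ≤ x ∧ x ≤ e) :
    IsLUB A (sSup A) ∧ sSup A ∈ Set.range T ∧ 0 ≤ sSup A ∧ sSup A ≤ e := by
  have hlub : IsLUB A (sSup A) := isLUB_csSup hne ⟨e, fun x hx => (hA x hx).2.2⟩
  obtain ⟨x, hx⟩ := id hne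
  exact ⟨hlub, hT.isLUB_mem hne (fun x hx => (hA x hx).1) hlub, (hA x hx).2.1.trans (hlub.1 hx),
    hlub.2 fun x hx => (hA x hx).2.2⟩

/-- All values lie between 0 and e, so `sSup` is a true supremum; by averaging the product of two
T-constants is again a T-constant, so the coefficient is one too. -/
theorem alphaT_spec (h : IsUniversalCompletion ι e) (hT : IsCondExp T) (hTe : T e = e)
    (V W : E →ₗ[ℝ] E) :
    IsLUB {x | ∃ P ∈ bandProjections e V, ∃ Q ∈ bandProjections e W,
      x = |T (P (Q e)) - mulE ι (T (P e)) (T (Q e))|} (alphaT ι e T V W) ∧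
    alphaT ι e T V W ∈ Set.range T ∧ 0 ≤ alphaT ι e T V W ∧ alphaT ι e T V W ≤ e := by
  refine hT.csSup_mem
    ⟨_, 0, zero_mem_bandProjections e V, 0, zero_mem_bandProjections e W, rfl⟩ ?_
  rintro _ ⟨P, hP, Q, hQ, rfl⟩
  have hPe := hP.1.2 e h.unit_nonneg
  have hQe := hQ.1.2 e h.unit_nonneg
  have hPQ := hP.1.2 _ hQe.1
  have h1 := hT.map_mem_Icc hTe hPe.1 hPe.2
  have h2 := hT.map_mem_Icc hTe hQe.1 hQe.2
  have h3 := hT.map_mem_Icc hTe hPQ.1 (hPQ.2.trans hQe.2)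
  obtain ⟨z, hz0, hze, hz⟩ := h.exists_mul_of_le_unit h1.1 h2.1 h2.2
  have hzm : mulE ι (T (P e)) (T (Q e)) = z := h.injective (by rw [map_mulE ι _ _ ⟨z, hz⟩, hz])
  have hTz : T z = z := h.injective (by
    rw [hT.averaging h hTe ⟨_, rfl⟩ h1.1 h2.1 hz, hT.idem, hz])
  rw [hzm]
  refine ⟨hT.abs_mem ⟨P (Q e) - z, by rw [map_sub, hTz]⟩, abs_nonneg _, ?_⟩
  exact abs_sub_le_of_mem_Icc h3.1 h3.2 hz0 (hze.trans h1.2)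

theorem map_sub_map_mem_Icc (h : IsUniversalCompletion ι e) (hT : IsCondExp T) (hTe : T e = e)
    {V W Q : E →ₗ[ℝ] E} (hV : IsCondExp V) (hVe : V e = e) (hQ : Q ∈ bandProjections e W) :
    |V (Q e) - T (Q e)| ≤ e := by
  have hQe := hQ.1.2 e h.unit_nonneg
  have h1 := hV.map_mem_Icc hVe hQe.1 hQe.2
  have h2 := hT.map_mem_Icc hTe hQe.1 hQe.2
  exact abs_sub_le_of_mem_Icc h1.1 h1.2 h2.1 h2.2

theorem phiT_spec (h : IsUniversalCompletion ι e) (hT : IsCondExp T) (hTe : T e = e)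
    {V : E →ₗ[ℝ] E} (hV : IsCondExp V) (hVe : V e = e) (W : E →ₗ[ℝ] E) :
    IsLUB {x | ∃ Q ∈ bandProjections e W, x = condNorm ι T .top (V (Q e) - T (Q e))}
      (phiT ι e T V W) ∧
    phiT ι e T V W ∈ Set.range T ∧ 0 ≤ phiT ι e T V W ∧ phiT ι e T V W ≤ e := by
  refine hT.csSup_mem ⟨_, 0, zero_mem_bandProjections e W, rfl⟩ ?_
  rintro _ ⟨Q, hQ, rfl⟩
  have h1 := map_sub_map_mem_Icc h hT hTe hV hVe hQ
  have hmem : V (Q e) - T (Q e) ∈ Lp ι T .top := ⟨e, ⟨e, hTe⟩, h.unit_nonneg, h1⟩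
  exact ⟨hT.condNorm_top_mem hmem, condNorm_top_nonneg hmem, condNorm_top_le ⟨e, hTe⟩ h1⟩

/-- A linear map that is small on the measurable components of `T`-constants is small on all
measurable elements that are bounded by a `T`-constant. -/
theorem IsCondExp.layer_bound (h : IsUniversalCompletion ι e) {W : E →ₗ[ℝ] E} (hW : IsCondExp W)
    (hWe : W e = e) (hTW : Set.range T ⊆ Set.range W) {a g : E} (ha : a ∈ Set.range T)
    (hg : g ∈ Set.range W) (hga : |g| ≤ a) (L : E →ₗ[ℝ] U) (κ : U) (hLa : L a = 0)
    (hLd : ∀ d ∈ Set.range T, 0 ≤ d → ∀ (b : U) (hb : b * b = b),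
      h.bandMul hb e ∈ Set.range W → L (h.bandMul hb d) ≤ ι d * κ)
    (hLr : ∀ d ∈ Set.range T, ∀ r, 0 ≤ r → r ≤ d → L r ≤ ι d) :
    L g ≤ (2 : ℝ) • (ι a * κ) := by
  have ha0 : 0 ≤ a := (abs_nonneg g).trans hga
  have hιa := h.nonneg_iff.2 ha0
  refine sub_nonpos.1 (nonpos_of_le_inv_smul (y := (2 : ℝ) • ι a)
    (smul_nonneg zero_le_two hιa) fun k => ?_)
  -- The shifted element g + a has height at most 2a, and L a = 0 makes the shift free. Mesh
  -- 2a/(k+1) with k + 1 layers gives total weight exactly 2a; the remainder costs at most one mesh.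
  have hc : (0 : ℝ) ≤ ((k + 1 : ℕ) : ℝ)⁻¹ * 2 := by positivity
  set c : ℝ := ((k + 1 : ℕ) : ℝ)⁻¹ * 2 with hcdef
  have hkc : ((k + 1 : ℕ) : ℝ) * c = 2 := mul_inv_cancel_left₀ (by positivity) 2
  have hd0 : 0 ≤ c • a := smul_nonneg hc ha0
  have hdT : c • a ∈ Set.range T := by
    obtain ⟨y, rfl⟩ := ha
    exact ⟨c • y, map_smul _ _ _⟩
  obtain ⟨q, hq, hqW, hl, hu⟩ := hW.exists_layers h hWe (g := g + a) (d := c • a) (N := k + 1)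
    (by
      obtain ⟨y, rfl⟩ := hg
      obtain ⟨z, hz⟩ := hTW ha
      exact ⟨y + z, by rw [map_add, hz]⟩)
    (hTW hdT) (by rw [add_comm, ← neg_le_iff_add_nonneg]; exact (neg_le_abs g).trans hga) hd0
    (by
      rw [← Nat.cast_smul_eq_nsmul ℝ, smul_smul, hkc, two_smul]
      exact add_le_add_left ((le_abs_self g).trans hga) a)
  set s := ∑ i ∈ Finset.range (k + 1), h.bandMul (hq i) (c • a) with hs
  have hιs : ι s = ∑ i ∈ Finset.range (k + 1), q i * ι (c • a) := by
    rw [hs, map_sum]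
    exact Finset.sum_congr rfl fun i _ => h.map_bandMul _ _
  rw [← hιs, ← map_sub] at hl hu
  have h1 := hLr _ hdT _ (h.nonneg_iff.1 hl) (h.le_iff.1 hu)
  have h2 : L s ≤ (2 : ℝ) • (ι a * κ) := by
    rw [hs, map_sum]
    refine (Finset.sum_le_card_nsmul _ _ _ fun i _ => hLd _ hdT hd0 _ (hq i) (hqW i)).trans_eq ?_
    rw [Finset.card_range, ← Nat.cast_smul_eq_nsmul ℝ, map_smul, smul_mul_assoc, smul_smul, hkc]
  rw [map_sub, map_add, hLa, add_zero, map_smul] at h1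
  rw [smul_smul]
  refine le_of_sub_eq (add_nonneg (sub_nonneg.2 h1) (sub_nonneg.2 h2)) ?_
  abel

section

variable (h : IsUniversalCompletion ι e) (hT : IsCondExp T) (hTe : T e = e)
  {V W : E →ₗ[ℝ] E} (hV : IsCondExp V) (hVe : V e = e) (hW : IsCondExp W) (hWe : W e = e)
  (hTW : Set.range T ⊆ Set.range W)
  {a g : E} (ha : a ∈ Set.range T) (hg : g ∈ Set.range W) (hga : |g| ≤ a) (hTg : T g = 0)
include h hT hTe hV hVe hW hWe hTW ha hg hga hTg

/-- The mixing inequality for the strong mixing coefficient. -/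
theorem map_abs_le_alphaT (hVT : IsCompatible V T) :
    ι (T |V g|) ≤ ι a * ι ((4 : ℝ) • alphaT ι e T V W) := by
  have ha0 : 0 ≤ a := (abs_nonneg g).trans hga
  obtain ⟨hlub, hαT, hα0, -⟩ := alphaT_spec h hT hTe V W
  -- P projects onto the band where V g > 0. Since T V g = T g = 0, T|V g| is twice T (V g)⁺ = T P
  -- g, which doubles the bound 2aα.
  have hb := h.supp_idem (h.nonneg_iff.2 (posPart_nonneg (V g)))
  set b := supp (ι (V g)⁺) with hbdef
  have hbV := hV.supp_mem h hVe (hV.posPart_mem ⟨g, rfl⟩) hb rfl (posPart_nonneg _)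
  set P := h.bandMul hb with hPdef
  have hPe0 : 0 ≤ P e := h.bandMul_nonneg hb h.unit_nonneg
  have h1 : T |V g| = (2 : ℝ) • T (P g) := by
    have h2 : P (V g) = (V g)⁺ := by
      apply h.injective
      rw [h.map_bandMul, hbdef, h.map_posPart, h.supp_posPart_mul]
    have h3 : |V g| = (2 : ℝ) • (V g)⁺ - V g := by
      have h4 : (V g)⁺ + (V g)⁻ = (2 : ℝ) • (V g)⁺ - ((V g)⁺ - (V g)⁻) := by module
      rwa [posPart_add_negPart, posPart_sub_negPart] at h4
    rw [h3, map_sub, map_smul, ← h2, ← hV.map_bandMul_comm h hVe hb hbV, hVT.2, hVT.2, hTg,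
      sub_zero]
  have hav : ∀ d ∈ Set.range T, 0 ≤ d → ∀ x, 0 ≤ x → ∀ z, ι z = ι d * ι x →
      ι (T z) = ι d * ι (T x) := fun d hd hd0 x hx z hz => hT.averaging h hTe hd hd0 hx hz
  -- The map x ↦ T P x - T P e · T x is the covariance with P e: it kills T-constants, and on Q d it
  -- is d times the difference controlled by α.
  have key := hW.layer_bound h hWe hTW ha hg hga
    (ι ∘ₗ T ∘ₗ P - LinearMap.mulLeft ℝ (ι (T (P e))) ∘ₗ ι ∘ₗ T) (ι (alphaT ι e T V W)) ?_ ?_ ?_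
  · simp only [LinearMap.sub_apply, LinearMap.comp_apply, hTg, map_zero,
      sub_zero] at key
    rw [h1, map_smul, map_smul]
    refine (smul_le_smul_of_nonneg_left key zero_le_two).trans_eq ?_
    rw [smul_smul, mul_smul_comm]
    norm_num
  · simp only [LinearMap.sub_apply, LinearMap.comp_apply, LinearMap.mulLeft_apply]
    rw [hav a ha ha0 (P e) hPe0 (P a) (by rw [h.map_bandMul, h.map_bandMul_unit, mul_comm]),
      hT.apply_of_mem ha]
    ring
  · intro d hd hd0 q hq hqW
    have hQe0 : 0 ≤ h.bandMul hq e := h.bandMul_nonneg hq h.unit_nonneg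
    have hQe : h.bandMul hq e ≤ e := h.bandMul_le hq h.unit_nonneg
    simp only [LinearMap.sub_apply, LinearMap.comp_apply, LinearMap.mulLeft_apply]
    rw [hav d hd hd0 (P (h.bandMul hq e)) (h.bandMul_nonneg hb hQe0) _ (by
        simp only [hPdef, h.map_bandMul, h.map_unit]; ring),
      hav d hd hd0 (h.bandMul hq e) hQe0 (h.bandMul hq d) (by simp only [h.map_bandMul, h.map_unit]; ring)]
    have h4 := hT.map_mem_Icc hTe hPe0 (h.bandMul_le hb h.unit_nonneg)
    have h5 := hT.map_mem_Icc hTe hQe0 hQe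
    obtain ⟨z, -, -, hz⟩ := h.exists_mul_of_le_unit h4.1 h5.1 h5.2
    have h6 := (le_abs_self _).trans (hlub.1 ⟨P, ⟨h.isBandProjection_bandMul hb, hbV⟩,
      h.bandMul hq, ⟨h.isBandProjection_bandMul hq, hqW⟩, rfl⟩)
    rw [← h.le_iff, map_sub, map_mulE ι _ _ ⟨z, hz⟩] at h6
    refine le_trans (le_of_eq ?_) (mul_le_mul_of_nonneg_left h6 (h.nonneg_iff.2 hd0))
    ring
  · intro d hd r hr0 hr
    simp only [LinearMap.sub_apply, LinearMap.comp_apply, LinearMap.mulLeft_apply]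
    refine (sub_le_self _ (mul_nonneg (h.nonneg_iff.2 (hT.map_nonneg _ hPe0))
      (h.nonneg_iff.2 (hT.map_nonneg _ hr0)))).trans ?_
    rw [h.le_iff]
    exact (hT.mono ((h.bandMul_le hb hr0).trans hr)).trans_eq (hT.apply_of_mem hd)

/-- The mixing inequality for the uniform mixing coefficient. -/
theorem map_abs_le_phiT (hTV : Set.range T ⊆ Set.range V) :
    ι (T |V g|) ≤ ι a * ι ((2 : ℝ) • phiT ι e T V W) := by
  have ha0 : 0 ≤ a := (abs_nonneg g).trans hga
  obtain ⟨hlub, hφT, hφ0, hφe⟩ := phiT_spec h hT hTe hV hVe W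
  have hval : ∀ d ∈ Set.range T, 0 ≤ d → ∀ (q : U) (hq : q * q = q),
      h.bandMul hq e ∈ Set.range W →
      ι (V (h.bandMul hq d)) - ι (T (h.bandMul hq d)) =
        ι d * ι (V (h.bandMul hq e) - T (h.bandMul hq e)) ∧
      |V (h.bandMul hq e) - T (h.bandMul hq e)| ≤ phiT ι e T V W := by
    intro d hd hd0 q hq hqW
    have hQe0 : 0 ≤ h.bandMul hq e := h.bandMul_nonneg hq h.unit_nonneg
    have hz : ι (h.bandMul hq d) = ι d * ι (h.bandMul hq e) := by
      simp only [h.map_bandMul, h.map_unit]; ring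
    have hQ : h.bandMul hq ∈ bandProjections e W := ⟨h.isBandProjection_bandMul hq, hqW⟩
    refine ⟨?_, ?_⟩
    · rw [hV.averaging h hVe (hTV hd) hd0 hQe0 hz, hT.averaging h hTe hd hd0 hQe0 hz, map_sub]
      ring
    · exact (abs_le_condNorm_top (ι := ι) ⟨e, ⟨e, hTe⟩, h.unit_nonneg,
        map_sub_map_mem_Icc h hT hTe hV hVe hQ⟩).trans (hlub.1 ⟨_, hQ, rfl⟩)
  have hVd : ∀ d ∈ Set.range T, ∀ r, 0 ≤ r → r ≤ d →
      (0 ≤ ι (V r) ∧ ι (V r) ≤ ι d) ∧ (0 ≤ ι (T r) ∧ ι (T r) ≤ ι d) := by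
    intro d hd r hr0 hr
    rw [h.nonneg_iff, h.nonneg_iff, h.le_iff, h.le_iff]
    exact ⟨⟨hV.map_nonneg _ hr0, (hV.mono hr).trans_eq (hV.apply_of_mem (hTV hd))⟩,
      hT.map_nonneg _ hr0, (hT.mono hr).trans_eq (hT.apply_of_mem hd)⟩
  have key1 := hW.layer_bound h hWe hTW ha hg hga (ι ∘ₗ V - ι ∘ₗ T) (ι (phiT ι e T V W))
    (by simp [hV.apply_of_mem (hTV ha), hT.apply_of_mem ha])
    (fun d hd hd0 q hq hqW => by
      obtain ⟨h1, h2⟩ := hval d hd hd0 q hq hqW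
      simp only [LinearMap.sub_apply, LinearMap.comp_apply]
      rw [h1]
      exact mul_le_mul_of_nonneg_left (h.le_iff.2 ((le_abs_self _).trans h2)) (h.nonneg_iff.2 hd0))
    (fun d hd r hr0 hr => by
      obtain ⟨h1, h2⟩ := hVd d hd r hr0 hr
      exact (sub_le_self _ h2.1).trans h1.2)
  have key2 := hW.layer_bound h hWe hTW ha hg hga (ι ∘ₗ T - ι ∘ₗ V) (ι (phiT ι e T V W))
    (by simp [hV.apply_of_mem (hTV ha), hT.apply_of_mem ha])
    (fun d hd hd0 q hq hqW => by
      obtain ⟨h1, h2⟩ := hval d hd hd0 q hq hqW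
      simp only [LinearMap.sub_apply, LinearMap.comp_apply]
      rw [← neg_sub, h1, ← mul_neg, ← map_neg]
      exact mul_le_mul_of_nonneg_left (h.le_iff.2 ((neg_le_abs _).trans h2)) (h.nonneg_iff.2 hd0))
    (fun d hd r hr0 hr => by
      obtain ⟨h1, h2⟩ := hVd d hd r hr0 hr
      exact (sub_le_self _ h1.1).trans h2.2)
  obtain ⟨z, hz0, -, hz⟩ := h.exists_mul_of_le_unit ha0 hφ0 hφe
  simp only [LinearMap.sub_apply, LinearMap.comp_apply, hTg, map_zero, sub_zero, zero_sub]
    at key1 key2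
  rw [← hz, ← map_smul, h.le_iff] at key1
  rw [← hz, ← map_smul, ← map_neg, h.le_iff] at key2
  -- The two one-sided bounds give |V g| ≤ 2aφ pointwise; T fixes aφ because both factors are
  -- T-constants.
  have h3 := hT.mono (sup_le key1 key2)
  have h4 := hT.averaging h hTe ha ha0 hφ0 hz
  rw [hT.apply_of_mem hφT] at h4
  rw [map_smul] at h3
  refine (h.le_iff.2 h3).trans_eq ?_
  rw [map_smul, map_smul, h4, mul_smul_comm]

end

end

-- Order convergence and inclusions of ranges

section

variable {X : Type*} [AddCommGroup X] [Module ℝ X] [Lattice X] [IsOrderedAddMonoid X]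
  {I : Type*} {l : Filter I}

theorem OrderTendsto.squeeze {x y : I → X} (hx : OrderTendsto x l 0) (hyx : ∀ i, |y i| ≤ x i) :
    OrderTendsto y l 0 := by
  obtain ⟨D, hne, hdir, hglb, hD⟩ := hx
  refine ⟨D, hne, hdir, hglb, fun d hd => (hD d hd).mono fun i hi => ?_⟩
  rw [sub_zero] at hi ⊢
  exact (hyx i).trans ((le_abs_self _).trans hi)

theorem OrderTendsto.comp {J : Type*} {l' : Filter J} {x : I → X} {a : X}
    (hx : OrderTendsto x l a) {u : J → I} (hu : Tendsto u l' l) :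
    OrderTendsto (fun j => x (u j)) l' a := by
  obtain ⟨D, hne, hdir, hglb, hD⟩ := hx
  exact ⟨D, hne, hdir, hglb, fun d hd => hu.eventually (hD d hd)⟩

theorem OrderTendsto.add {x y : I → X} (hx : OrderTendsto x l 0) (hy : OrderTendsto y l 0) :
    OrderTendsto (fun i => x i + y i) l 0 := by
  obtain ⟨D, hne, hdir, hglb, hD⟩ := hx
  obtain ⟨D', hne', hdir', hglb', hD'⟩ := hy
  refine ⟨Set.image2 (· + ·) D D', hne.image2 hne', ?_, ⟨?_, fun w hw => ?_⟩, ?_⟩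
  · rintro _ ⟨a, ha, b, hb, rfl⟩ _ ⟨c, hc, d, hd, rfl⟩
    obtain ⟨p, hp, hpa, hpc⟩ := hdir a ha c hc
    obtain ⟨q, hq, hqb, hqd⟩ := hdir' b hb d hd
    exact ⟨_, ⟨p, hp, q, hq, rfl⟩, add_le_add hpa hqb, add_le_add hpc hqd⟩
  · rintro _ ⟨a, ha, b, hb, rfl⟩
    exact add_nonneg (hglb.1 ha) (hglb'.1 hb)
  · refine hglb.2 fun a ha => sub_nonpos.1 (hglb'.2 fun b hb => ?_)
    exact sub_le_iff_le_add'.2 (hw ⟨a, ha, b, hb, rfl⟩)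
  · rintro _ ⟨a, ha, b, hb, rfl⟩
    filter_upwards [hD a ha, hD' b hb] with i hi hi'
    rw [sub_zero] at hi hi' ⊢
    exact (abs_add_le _ _).trans (add_le_add hi hi')

theorem OrderTendsto.two_smul {x : I → X} (hx : OrderTendsto x l 0) :
    OrderTendsto (fun i => (2 : ℝ) • x i) l 0 := by
  simpa only [_root_.two_smul] using hx.add hx

theorem generated_mono {A B : Set X} (hAB : A ⊆ B) : generated A ⊆ generated B :=
  fun _ hx F hF hFc => hx F (hAB.trans hF) hFc

theorem subset_generated (A : Set X) : A ⊆ generated A :=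
  fun _ hx _ hF _ => hF hx

theorem IsCompatible.range_subset {S T : X →ₗ[ℝ] X} (h : IsCompatible S T) :
    Set.range T ⊆ Set.range S := by
  rintro _ ⟨x, rfl⟩
  exact ⟨T x, h.1 x⟩

theorem IsCompatible.map_unit {S T : X →ₗ[ℝ] X} (h : IsCompatible S T) {e : X} (hTe : T e = e) :
    S e = e := by
  rw [← hTe, h.1]

end

-- Comparison of norms and the mixingale bounds

section

variable {E U : Type*}
  [AddCommGroup E] [Module ℝ E] [ConditionallyCompleteLattice E] [IsOrderedAddMonoid E]
  [IsOrderedModule ℝ E]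
  [CommRing U] [Algebra ℝ U] [ConditionallyCompleteLattice U] [IsOrderedRing U]
  [IsOrderedModule ℝ U]
  {ι : E →ₗ[ℝ] U} {e : E} {T : E →ₗ[ℝ] E}

theorem IsPast.range_mono {S : ℤ → ℤ → E →ₗ[ℝ] E} {past : ℤ → E →ₗ[ℝ] E}
    (hpast : IsPast T S past) {m n : ℤ} (hmn : m ≤ n) :
    Set.range (past m) ⊆ Set.range (past n) := by
  rw [hpast.range_eq, hpast.range_eq]
  refine generated_mono ?_
  rintro x ⟨i, j, hij, hjm, hx⟩
  exact ⟨i, j, hij, hjm.trans hmn, hx⟩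

theorem IsPast.range_subset {S : ℤ → ℤ → E →ₗ[ℝ] E} {past : ℤ → E →ₗ[ℝ] E}
    (hpast : IsPast T S past) {i j n : ℤ} (hij : i ≤ j) (hjn : j ≤ n) :
    Set.range (S i j) ⊆ Set.range (past n) := by
  rw [hpast.range_eq]
  exact fun x hx => subset_generated _ ⟨i, j, hij, hjn, hx⟩

theorem IsFuture.range_subset {S : ℤ → ℤ → E →ₗ[ℝ] E} {future : ℤ → E →ₗ[ℝ] E}
    (hfuture : IsFuture T S future) {i j n : ℤ} (hij : i ≤ j) (hni : n ≤ i) :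
    Set.range (S i j) ⊆ Set.range (future n) := by
  rw [hfuture.range_eq]
  exact fun x hx => subset_generated _ ⟨i, j, hni, hij, hx⟩

/-- Since (1 - y)² ≥ 0, also y ≤ 1 + y². This bounds the set whose supremum defines `sqrtE`. -/
theorem IsUniversalCompletion.le_unit_add (h : IsUniversalCompletion ι e) {x y : E} (hy : 0 ≤ y)
    (hyx : ι y * ι y ≤ ι x) : y ≤ e + x := by
  rw [← h.le_iff, map_add, h.map_unit]
  refine le_of_sub_eq (add_nonneg (add_nonneg (sub_nonneg.2 hyx) (h.sq_nonneg' (1 - ι y)))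
    (h.nonneg_iff.2 hy)) ?_
  ring

/-- For p = 2, Jensen makes T|u| a member of the set defining the square root. For p = ∞, every
admissible T-constant g satisfies T|u| ≤ T g = g. -/
theorem map_abs_le_condNorm (h : IsUniversalCompletion ι e) (hT : IsCondExp T) (hTe : T e = e)
    (p : Exponent) {u : E} (hu : u ∈ Lp ι T p) : T |u| ≤ condNorm ι T p u := by
  cases p with
  | one => exact le_rfl
  | two =>
    obtain ⟨z, hz⟩ := hu
    have hz' : ι z = ι |u| * ι |u| := by rw [hz, h.map_abs, h.abs_mul_abs']
    have hm : mulE ι |u| |u| = z := h.injective (by rw [map_mulE ι _ _ ⟨z, hz'⟩, hz'])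
    change _ ≤ sqrtE ι (T (mulE ι |u| |u|))
    rw [hm]
    refine le_csSup ⟨e + T z, fun y hy => h.le_unit_add hy.1 hy.2⟩ ⟨?_, ?_⟩
    · exact hT.map_nonneg _ (abs_nonneg u)
    · exact hT.sq_map_le h hTe (abs_nonneg u) hz'
  | top =>
    refine (isGLB_condNorm_top hu).2 fun g hg => ?_
    exact (hT.mono hg.2.2).trans_eq (hT.apply_of_mem hg.1)

/-- Membership is needed because outside these spaces the norms for p = 2 and p = ∞ take default
values. For p = 2, the square of f - S f is at most 2(f² + S f²), and E is an ideal. -/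
theorem sub_map_mem_Lp (h : IsUniversalCompletion ι e) (hTe : T e = e)
    {S : E →ₗ[ℝ] E} (hS : IsCondExp S) (hST : IsCompatible S T) (p : Exponent) {f : E}
    (hf : f ∈ Lp ι T p) : f - S f ∈ Lp ι T p := by
  have habs : |f - S f| ≤ |f| + S |f| :=
    (abs_sub_le_add f (S f)).trans (add_le_add_right (hS.abs_map_le f) _)
  cases p with
  | one => exact Set.mem_univ _
  | two =>
    obtain ⟨z, hz⟩ := hf
    have hz' : ι z = ι |f| * ι |f| := by rw [hz, h.map_abs, h.abs_mul_abs']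
    have h1 := hS.sq_map_le h (hST.map_unit hTe) (abs_nonneg f) hz'
    have h2 := h.le_iff.2 habs
    have h3 := h.nonneg_iff.2 (abs_nonneg (f - S f))
    refine h.exists_of_abs_le (x := z + z + (S z + S z)) ?_
    rw [abs_of_nonneg (h.sq_nonneg' _), ← h.abs_mul_abs', ← h.map_abs]
    refine (mul_le_mul h2 h2 h3 (h3.trans h2)).trans ?_
    simp only [map_add]
    refine le_of_sub_eq (add_nonneg (add_nonneg (sub_nonneg.2 h1) (sub_nonneg.2 h1))
      (h.sq_nonneg' (ι |f| - ι (S |f|)))) ?_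
    linear_combination 2 * hz'
  | top =>
    obtain ⟨g, ⟨y, rfl⟩, hg0, hfg⟩ := hf
    refine ⟨T y + T y, ⟨y + y, map_add _ _ _⟩, add_nonneg hg0 hg0, habs.trans ?_⟩
    exact add_le_add hfg ((hS.mono hfg).trans_eq (hST.1 y))

theorem alphaSeq_spec (h : IsUniversalCompletion ι e) (hT : IsCondExp T) (hTe : T e = e)
    (past future : ℤ → E →ₗ[ℝ] E) (m : ℕ) :
    IsLUB (Set.range fun n : ℤ => alphaT ι e T (past n) (future (n + m)))
      (alphaSeq ι e T past future m) ∧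
    alphaSeq ι e T past future m ∈ Set.range T ∧ 0 ≤ alphaSeq ι e T past future m ∧
    alphaSeq ι e T past future m ≤ e := by
  refine hT.csSup_mem (Set.range_nonempty _) ?_
  rintro _ ⟨n, rfl⟩
  exact (alphaT_spec h hT hTe _ _).2

theorem phiSeq_spec (h : IsUniversalCompletion ι e) (hT : IsCondExp T) (hTe : T e = e)
    {past : ℤ → E →ₗ[ℝ] E} (hpast : ∀ n, IsCondExp (past n)) (hpe : ∀ n, past n e = e)
    (future : ℤ → E →ₗ[ℝ] E) (m : ℕ) :
    IsLUB (Set.range fun n : ℤ => phiT ι e T (past n) (future (n + m)))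
      (phiSeq ι e T past future m) ∧
    phiSeq ι e T past future m ∈ Set.range T ∧ 0 ≤ phiSeq ι e T past future m ∧
    phiSeq ι e T past future m ≤ e := by
  refine hT.csSup_mem (Set.range_nonempty _) ?_
  rintro _ ⟨n, rfl⟩
  exact (phiT_spec h hT hTe (hpast n) (hpe n) _).2

/-- The mixing inequality for both mixing coefficients. -/
theorem map_abs_le_mixing (h : IsUniversalCompletion ι e) (hT : IsCondExp T) (hTe : T e = e)
    {V W : E →ₗ[ℝ] E} (hV : IsCondExp V) (hVT : IsCompatible V T) (hW : IsCondExp W)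
    (hWT : IsCompatible W T) {a g : E} (ha : a ∈ Set.range T) (hg : g ∈ Set.range W)
    (hga : |g| ≤ a) (hTg : T g = 0) {A B : E} (hA : alphaT ι e T V W ≤ A)
    (hB : phiT ι e T V W ≤ B) :
    ι (T |V g|) ≤ (2 : ℝ) • (ι a * ι (((2 : ℝ) • A) ⊓ B)) := by
  have ha0 : 0 ≤ ι a := h.nonneg_iff.2 ((abs_nonneg g).trans hga)
  have hVe := hVT.map_unit hTe
  have hWe := hWT.map_unit hTe
  have h1 := map_abs_le_alphaT h hT hTe hV hVe hW hWe hWT.range_subset ha hg hga hTg hVT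
  have h2 := map_abs_le_phiT h hT hTe hV hVe hW hWe hWT.range_subset ha hg hga hTg hVT.range_subset
  -- Halving 4aα and 2aφ gives a·2α and a·φ; multiplication by a ≥ 0 preserves infima, so the two
  -- bounds merge into one minimum.
  have h3 : (2⁻¹ : ℝ) • ι (T |V g|) ≤ ι a * ι ((2 : ℝ) • A) := by
    have h4 := mul_le_mul_of_nonneg_left (h.le_iff.2 (smul_le_smul_of_nonneg_left hA
      (by norm_num : (0 : ℝ) ≤ 4))) ha0
    have h5 := smul_le_smul_of_nonneg_left (h1.trans h4) (by norm_num : (0 : ℝ) ≤ 2⁻¹)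
    refine h5.trans_eq ?_
    rw [map_smul, map_smul, mul_smul_comm, mul_smul_comm, smul_smul]
    norm_num
  have h3' : (2⁻¹ : ℝ) • ι (T |V g|) ≤ ι a * ι B := by
    have h4 := mul_le_mul_of_nonneg_left (h.le_iff.2 (smul_le_smul_of_nonneg_left hB
      (by norm_num : (0 : ℝ) ≤ 2))) ha0
    have h5 := smul_le_smul_of_nonneg_left (h2.trans h4) (by norm_num : (0 : ℝ) ≤ 2⁻¹)
    refine h5.trans_eq ?_
    rw [map_smul, mul_smul_comm, smul_smul]
    norm_num
  have h6 := le_inf h3 h3'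
  rw [← h.mul_inf ha0, ← h.map_inf] at h6
  have h7 := smul_le_smul_of_nonneg_left h6 (zero_le_two : (0 : ℝ) ≤ 2)
  rwa [smul_smul, mul_inv_cancel₀ two_ne_zero, one_smul] at h7

theorem IsNEDWith.isMixingaleWith (h : IsUniversalCompletion ι e)
    (hT : IsCondExp T) (hTe : T e = e) (hTpos : IsStrictlyPositive T)
    {S : ℤ → ℤ → E →ₗ[ℝ] E} (hS : IsNestedFamily T S) {past future : ℤ → E →ₗ[ℝ] E}
    (hpast : IsPast T S past) (hfuture : IsFuture T S future) {p : Exponent} {f : ℤ → E}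
    (hf : ∀ n, f n ∈ Lp ι T .top)
    (hmix : IsAlphaMixing ι e T past future ∨ IsPhiMixing ι e T past future)
    (hmean : ∀ n, T (f n) = 0) {d : ℤ → E} {ξ : ℕ → E} (hned : IsNEDWith ι T p S f d ξ) :
    IsMixingaleWith ι T .one f past
      (fun n => d n ⊔ condNorm ι T .top (f n))
      (fun m => (2 : ℝ) • (ξ (m / 2) +
        ((2 : ℝ) • alphaSeq ι e T past future (m / 2)) ⊓ phiSeq ι e T past future (m / 2))) := by
  have hpe : ∀ n, past n e = e := fun n => (hpast.compatible n).map_unit hTe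
  have hα := alphaSeq_spec h hT hTe past future
  have hφ := phiSeq_spec h hT hTe hpast.condExp hpe future
  set κ : ℕ → E := fun k =>
    ((2 : ℝ) • alphaSeq ι e T past future k) ⊓ phiSeq ι e T past future k with hκ
  have hα2 : ∀ k, 0 ≤ (2 : ℝ) • alphaSeq ι e T past future k := fun k =>
    smul_nonneg zero_le_two (hα k).2.2.1
  have hκ0 : ∀ k, 0 ≤ κ k := fun k => le_inf (hα2 k) (hφ k).2.2.1
  have hd : ∀ n, ι (d n) ≤ ι (d n ⊔ condNorm ι T .top (f n)) := fun n =>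
    h.le_iff.2 le_sup_left
  have ha : ∀ n, ι (condNorm ι T .top (f n)) ≤ ι (d n ⊔ condNorm ι T .top (f n)) := fun n =>
    h.le_iff.2 le_sup_right
  have happrox : ∀ (n : ℤ) (k : ℕ),
      ι (T |f n - S (n - k) (n + k) (f n)|) ≤ ι (d n) * ι (ξ k) := by
    intro n k
    have hk : n - (k : ℤ) ≤ n + k := by lia
    refine le_trans (h.le_iff.2 ?_) (hned.bound n k)
    exact map_abs_le_condNorm h hT hTe p (sub_map_mem_Lp h hTe (hS.condExp _ _ hk)
      (hS.compatible _ _ hk) p (hned.mem n))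
  have hcontr : ∀ n x, T |past n x| ≤ T |x| := fun n x =>
    (hT.mono ((hpast.condExp n).abs_map_le x)).trans_eq ((hpast.compatible n).2 _)
  have hξle : ∀ n k, ι (d n) * ι (ξ k) ≤ ι (d n ⊔ condNorm ι T .top (f n)) * ι (ξ k) :=
    fun n k => mul_le_mul_of_nonneg_right (hd n) (h.nonneg_iff.2 (hned.xi_nonneg k))
  have hcκ : ∀ n k, 0 ≤ ι (d n ⊔ condNorm ι T .top (f n)) * ι (κ k) := fun n k =>
    mul_nonneg ((h.nonneg_iff.2 (hned.d_nonneg n)).trans (hd n)) (h.nonneg_iff.2 (hκ0 k))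
  have hcξ : ∀ n k, 0 ≤ ι (d n ⊔ condNorm ι T .top (f n)) * ι (ξ k) := fun n k =>
    mul_nonneg ((h.nonneg_iff.2 (hned.d_nonneg n)).trans (hd n))
      (h.nonneg_iff.2 (hned.xi_nonneg k))
  have hexpand : ∀ c x y : E, ι c * ι ((2 : ℝ) • (x + y)) =
      ι c * ι x + ι c * ι x + (ι c * ι y + ι c * ι y) := by
    intro c x y
    rw [map_smul, map_add, two_smul]
    ring
  refine
    { condExp := hpast.condExp
      compatible := hpast.compatible
      filtration := fun m n hmn x => ⟨?_, ?_⟩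
      mem := fun n => Set.mem_univ _
      c_mem := fun n => Set.mem_univ _
      c_nonneg := fun n => (hned.d_nonneg n).trans le_sup_left
      phi_mem := fun m => ?_
      phi_nonneg := fun m => smul_nonneg zero_le_two (add_nonneg (hned.xi_nonneg _) (hκ0 _))
      phi_tendsto := ?_
      bound_past := fun n m => ?_
      bound_future := fun n m => ?_ }
  · exact IsCondExp.tower h hTpos (hpast.condExp m) (hpast.condExp n) (hpast.compatible m)
      (hpast.compatible n) (hpe m) (hpe n) (hpast.range_mono hmn) x
  · exact (hpast.condExp n).apply_of_mem (hpast.range_mono hmn ⟨x, rfl⟩)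
  · obtain ⟨x, hx⟩ := hned.xi_mem (m / 2)
    obtain ⟨y, hy⟩ : κ (m / 2) ∈ Set.range T := by
      refine hT.range_inf _ _ ?_ (hφ _).2.1
      obtain ⟨y, hy⟩ := (hα (m / 2)).2.1
      exact ⟨(2 : ℝ) • y, by rw [map_smul, hy]⟩
    exact ⟨(2 : ℝ) • (x + y), by rw [map_smul, map_add, hx, hy]⟩
  · have hκt : OrderTendsto κ atTop 0 := by
      rcases hmix with hm | hm
      · refine OrderTendsto.squeeze hm.two_smul fun k => ?_
        rw [abs_of_nonneg (hκ0 k)]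
        exact inf_le_left
      · refine OrderTendsto.squeeze hm fun k => ?_
        rw [abs_of_nonneg (hκ0 k)]
        exact inf_le_right
    exact ((hned.xi_tendsto.add hκt).two_smul).comp (Nat.tendsto_div_const_atTop two_ne_zero)
  · set k := m / 2 with hk
    -- This is n - m + k ≤ n - k: the window around n starts at least k after the past ends at n -
    -- m.
    have hkm : k + k ≤ m := by lia
    set g := S (n - k) (n + k) (f n) with hg
    have hSk : n - (k : ℤ) ≤ n + k := by lia
    have hScond := hS.condExp _ _ hSk
    have hScomp := hS.compatible _ _ hSk
    have haT := hT.condNorm_top_mem (hf n)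
    have hga : |g| ≤ condNorm ι T .top (f n) := by
      refine (hScond.abs_map_le _).trans ((hScond.mono (abs_le_condNorm_top (hf n))).trans_eq ?_)
      exact hScond.apply_of_mem (hScomp.range_subset haT)
    have h1 := map_abs_le_mixing h hT hTe (hpast.condExp (n - m)) (hpast.compatible (n - m))
      (hfuture.condExp (n - m + k)) (hfuture.compatible (n - m + k)) haT
      (hfuture.range_subset hSk (by lia) ⟨f n, rfl⟩) hga
      ((hScomp.2 _).trans (hmean n)) ((hα k).1.1 ⟨n - m, rfl⟩) ((hφ k).1.1 ⟨n - m, rfl⟩)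
    have h2 : T |past (n - m) (f n)| ≤ T |f n - g| + T |past (n - m) g| := by
      have h3 : past (n - m) (f n) = past (n - m) (f n - g) + past (n - m) g := by
        rw [← map_add, sub_add_cancel]
      rw [h3]
      refine (hT.mono (abs_add_le _ _)).trans ?_
      rw [map_add]
      exact add_le_add_left (hcontr _ _) _
    have h4 := mul_le_mul_of_nonneg_right (ha n) (h.nonneg_iff.2 (hκ0 k))
    change ι (T |past (n - m) (f n)|) ≤ ι (d n ⊔ condNorm ι T .top (f n)) *
      ι ((2 : ℝ) • (ξ k + κ k))
    refine (h.le_iff.2 h2).trans ?_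
    rw [map_add, hexpand]
    refine add_le_add (((happrox n k).trans (hξle n k)).trans (le_add_of_nonneg_left (hcξ n k)))
      (h1.trans ?_)
    rw [two_smul]
    exact add_le_add h4 h4
  · set k := (m + 1) / 2 with hk
    have hkm : k ≤ m := by lia
    set g := S (n - k) (n + k) (f n) with hg
    have hgV : past (n + m) g = g := (hpast.condExp (n + m)).apply_of_mem
      (hpast.range_subset (by lia : n - (k : ℤ) ≤ n + k) (by lia) ⟨f n, rfl⟩)
    have h2 : T |f n - past (n + m) (f n)| ≤ T |f n - g| + T |f n - g| := by
      -- As the past operator fixes g, only f_n - g contributes, once directly and once through a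
      -- contraction; this uses the full factor 2 of φ and no mixing.
      have h3 : f n - past (n + m) (f n) = (f n - g) - past (n + m) (f n - g) := by
        rw [map_sub, hgV]
        abel
      rw [h3]
      refine (hT.mono (abs_sub_le_add _ _)).trans ?_
      rw [map_add]
      exact add_le_add_right (hcontr _ _) _
    have h4 := (happrox n k).trans (hξle n k)
    change ι (T |f n - past (n + m) (f n)|) ≤ ι (d n ⊔ condNorm ι T .top (f n)) *
      ι ((2 : ℝ) • (ξ k + κ k))
    refine (h.le_iff.2 h2).trans ?_
    rw [map_add, hexpand]
    exact (add_le_add h4 h4).trans (le_add_of_nonneg_right (add_nonneg (hcκ n k) (hcκ n k)))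

end

end RieszMixing

theorem theorem4p10 {E U : Type*}
    [AddCommGroup E] [Module ℝ E] [ConditionallyCompleteLattice E] [IsOrderedAddMonoid E]
    [IsOrderedModule ℝ E]
    [CommRing U] [Algebra ℝ U] [ConditionallyCompleteLattice U] [IsOrderedRing U]
    [IsOrderedModule ℝ U]
    (ι : E →ₗ[ℝ] U) (e : E) (T : E →ₗ[ℝ] E)
    (he : RieszMixing.IsWeakOrderUnit e)
    (hι : RieszMixing.IsUniversalCompletion ι e)
    (hT : RieszMixing.IsCondExp T) (hTe : T e = e)
    (hTpos : RieszMixing.IsStrictlyPositive T)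
    (hTc : RieszMixing.IsTUniversallyComplete ι T)
    (S : ℤ → ℤ → E →ₗ[ℝ] E) (hS : RieszMixing.IsNestedFamily T S)
    (past future : ℤ → E →ₗ[ℝ] E)
    (hpast : RieszMixing.IsPast T S past) (hfuture : RieszMixing.IsFuture T S future)
    (p : RieszMixing.Exponent) (f : ℤ → E)
    (hf : ∀ n, f n ∈ RieszMixing.Lp ι T .top)
    (hned : RieszMixing.IsNED ι T p S f)
    (hmix : RieszMixing.IsAlphaMixing ι e T past future ∨
      RieszMixing.IsPhiMixing ι e T past future)
    (hmean : ∀ n, T (f n) = 0) :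
    RieszMixing.IsMixingale ι T .one f past ∧
      ∀ (d : ℤ → E) (ξ : ℕ → E), RieszMixing.IsNEDWith ι T p S f d ξ →
        RieszMixing.IsMixingaleWith ι T .one f past
          (fun n => d n ⊔ RieszMixing.condNorm ι T .top (f n))
          (fun m => (2 : ℝ) • (ξ (m / 2) +
            ((2 : ℝ) • RieszMixing.alphaSeq ι e T past future (m / 2)) ⊓
              RieszMixing.phiSeq ι e T past future (m / 2))) := by
  have key : ∀ (d : ℤ → E) (ξ : ℕ → E), RieszMixing.IsNEDWith ι T p S f d ξ → _ :=
    fun d ξ h => h.isMixingaleWith hι hT hTe hTpos hS hpast hfuture hf hmix hmean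
  obtain ⟨d, ξ, h⟩ := hned
  exact ⟨⟨_, _, key d ξ h⟩, key⟩
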